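/- For $\tau\in\mathbb{C}$ with $\operatorname{Im}\tau>0$ write $q=e^{2\pi i\tau}$ and $q^{a}=e^{2\pi i a\tau}$, and let $$L(\tau)=E_2(\tau)=1-24\sum_{n=1}^\infty\frac{nq^n}{1-q^n},\qquad M(\tau)=E_4(\tau)=1+240\sum_{n=1}^\infty\frac{n^3q^n}{1-q^n}.$$ Let $$\theta_1(z|\tau)=-iq^{1/8}\sum_{n=-\infty}^{\infty}(-1)^nq^{n(n+1)/2}e^{(2n+1)iz},\qquad \theta_2(z|\tau)=2\sum_{n=0}^\infty q^{(2n+1)^2/8}\cos (2n+1)z,$$ $$\theta_3(z|\tau)=1+2\sum_{n=1}^\infty q^{n^2/2}\cos 2nz,\qquad \theta_4(z|\tau)=1+2\sum_{n=1}^\infty(-1)^nq^{n^2/2}\cos 2nz$$ be the Jacobi theta functions, and put $\vartheta_1'(\tau)=\frac{\partial\theta_1}{\partial z}(0|\tau)$ and $\vartheta_j(\tau)=\theta_j(0|\tau)$ for $j=2,3,4$. Then for every $\tau$ with $\operatorname{Im}\tau>0$, $$\bigl(9L(9\tau)-L(\tau)\bigr)^2+\frac15\bigl(42M(9\tau)-2M(\tau)\bigr)=\frac{72\,\vartheta_1'(9\tau)^5}{\vartheta_1'(\tau)}\left(\frac{\vartheta_2(\tau)}{\vartheta_2^5(9\tau)}-\frac{\vartheta_3(\tau)}{\vartheta_3^5(9\tau)}+\frac{\vartheta_4(\tau)}{\vartheta_4^5(9\tau)}\right).$$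 -/

import Mathlib

namespace ThetaEisenstein

noncomputable section

/-- The power `q ^ a` of the nome `q = exp (2 π i τ)`, with the branch
`q ^ a = exp (2 π i a τ)`. -/
def qPow (τ a : ℂ) : ℂ := Complex.exp (2 * Real.pi * Complex.I * a * τ)

/-- `L(τ) = E₂(τ) = 1 - 24 ∑_{n ≥ 1} n qⁿ / (1 - qⁿ)`. -/
def L (τ : ℂ) : ℂ := 1 - 24 * ∑' n : ℕ+, (n : ℂ) * qPow τ n / (1 - qPow τ n)

/-- `M(τ) = E₄(τ) = 1 + 240 ∑_{n ≥ 1} n³ qⁿ / (1 - qⁿ)`. -/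
def M (τ : ℂ) : ℂ := 1 + 240 * ∑' n : ℕ+, (n : ℂ) ^ 3 * qPow τ n / (1 - qPow τ n)

/-- `θ₁(z|τ) = -i q^{1/8} ∑_{n ∈ ℤ} (-1)ⁿ q^{n(n+1)/2} e^{(2n+1)iz}`. -/
def theta1 (z τ : ℂ) : ℂ :=
  -Complex.I * qPow τ (1 / 8) *
    ∑' n : ℤ, (-1 : ℂ) ^ n * qPow τ ((n : ℂ) * ((n : ℂ) + 1) / 2) *
      Complex.exp ((2 * (n : ℂ) + 1) * Complex.I * z)

/-- `θ₂(z|τ) = 2 ∑_{n ≥ 0} q^{(2n+1)²/8} cos((2n+1)z)`. -/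
def theta2 (z τ : ℂ) : ℂ :=
  2 * ∑' n : ℕ, qPow τ ((2 * (n : ℂ) + 1) ^ 2 / 8) * Complex.cos ((2 * (n : ℂ) + 1) * z)

/-- `θ₃(z|τ) = 1 + 2 ∑_{n ≥ 1} q^{n²/2} cos(2nz)`. -/
def theta3 (z τ : ℂ) : ℂ :=
  1 + 2 * ∑' n : ℕ+, qPow τ ((n : ℂ) ^ 2 / 2) * Complex.cos (2 * (n : ℂ) * z)

/-- `θ₄(z|τ) = 1 + 2 ∑_{n ≥ 1} (-1)ⁿ q^{n²/2} cos(2nz)`. -/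
def theta4 (z τ : ℂ) : ℂ :=
  1 + 2 * ∑' n : ℕ+, (-1 : ℂ) ^ (n : ℕ) * qPow τ ((n : ℂ) ^ 2 / 2) *
    Complex.cos (2 * (n : ℂ) * z)

/-- `ϑ₁'(τ) = θ₁'(0|τ)`, the derivative being taken with respect to `z`. -/
def vartheta1' (τ : ℂ) : ℂ := deriv (fun z : ℂ => theta1 z τ) 0

/-- `ϑ₂(τ) = θ₂(0|τ)`. -/
def vartheta2 (τ : ℂ) : ℂ := theta2 0 τ

/-- `ϑ₃(τ) = θ₃(0|τ)`. -/
def vartheta3 (τ : ℂ) : ℂ := theta3 0 τ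

/-- `ϑ₄(τ) = θ₄(0|τ)`. -/
def vartheta4 (τ : ℂ) : ℂ := theta4 0 τ

end

end ThetaEisenstein

/-!
The identity says that the residues of one elliptic function add up to zero. Put
`g(z) = θ₁(z|τ) / (θ₁(z|9τ)⁵ θ₁(2z|9τ))` (`thetaQuot`). Under `z ↦ z + 9πτ` the numerator acquires
the multiplier of a theta function of degree `9` for the lattice `ℤπ + ℤ 9πτ`, and so does the
denominator, of degree `5 + 4`; hence `g` has the periods `π` and `9πτ`. Its poles are the half
periods: simple ones at `π/2`, `9πτ/2` and `π/2 + 9πτ/2`, with residues given by the three quotients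
`ϑⱼ(τ) / ϑⱼ(9τ)⁵` (`removableAt_thetaQuot_halfPeriod`), and one of order five at `0`. The residue
at `0` is read off from `θ₁(z) / ϑ₁' = z - L z³ / 6 + (L² / 72 - M / 180) z⁵ + ⋯`
(`exists_theta1_eq_mul_hasJet`), which is where `L` and `M` come from
(`removableAt_thetaQuot_zero`).

The residue theorem (`thetaQuot_residues`) is proved without contour integrals. With
`ζ = θ₁'(·|9τ) / θ₁(·|9τ)`, a combination of `ζ`, its second and fourth
derivatives and its translates has the same polar parts as `g`. As `ζ(z + 9πτ) = ζ(z) - 2i`, the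
difference is entire, has period `π`, and changes under `z ↦ z + 9πτ` by `2i` times the sum of the
residues. By Liouville's theorem for its derivative it is constant (`quasiPeriodic_const`), so that
sum vanishes.

The zeros of `θ₁` and its expansion at `0` come from the product formula
`θ₁(z) = C sin z ∏ (1 - qⁿ e^{2iz})(1 - qⁿ e^{-2iz})` (`exists_theta1_eq_mul_thetaProd`). The same
Liouville argument gives it, since both sides have the same multipliers and `θ₁` vanishes at the
simple zeros of the product; the value of `C ≠ 0` is never needed. Written as
`θ₁(z) = C' sin z ∏ (1 + aₙ sin² z)` with `aₙ = 4qⁿ / (1 - qⁿ)²`, it reduces the expansion to the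
power sums `∑ aₙ` and `∑ aₙ²`, which are Lambert series (`tsum_sinCoeff`, `tsum_sinCoeff_sq`).
-/

namespace ThetaEisenstein

open Filter Topology Complex

/-! ### Removable singularities and Liouville's theorem on the torus -/

/-- `f` has a removable singularity at `p`: it agrees on a punctured neighbourhood of `p` with a
function analytic at `p`. The value `f p` itself plays no role. -/
def RemovableAt (f : ℂ → ℂ) (p : ℂ) : Prop :=
  ∃ g : ℂ → ℂ, AnalyticAt ℂ g p ∧ f =ᶠ[𝓝[≠] p] g

/-- `f (z + ω) = f z + c` away from a discrete set. The additive constant allows for functions such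
as the logarithmic derivative of `θ₁`. -/
def QuasiPeriodic (f : ℂ → ℂ) (ω c : ℂ) : Prop :=
  ∀ p, ∀ᶠ z in 𝓝[≠] p, f (z + ω) = f z + c

theorem tendsto_add_const_nhdsNE (p ω : ℂ) :
    Tendsto (fun z => z + ω) (𝓝[≠] p) (𝓝[≠] (p + ω)) := by
  refine tendsto_nhdsWithin_of_tendsto_nhds_of_eventually_within _ ?_ ?_
  · exact ((continuous_id.add continuous_const).tendsto p).mono_left nhdsWithin_le_nhds
  · filter_upwards [self_mem_nhdsWithin] with z hz
    simpa using hz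

theorem eventually_nhdsNE_eventually_nhds {P : ℂ → Prop} {p : ℂ} (h : ∀ᶠ z in 𝓝[≠] p, P z) :
    ∀ᶠ z in 𝓝[≠] p, ∀ᶠ w in 𝓝 z, P w := by
  have h1 := eventually_eventually_nhdsWithin.2 h
  filter_upwards [h1, self_mem_nhdsWithin] with z hz hzp
  rwa [(isOpen_compl_singleton).nhdsWithin_eq hzp] at hz

theorem eq_of_eventuallyEq_nhdsNE {f g : ℂ → ℂ} {p : ℂ} (hf : ContinuousAt f p)
    (hg : ContinuousAt g p) (h : f =ᶠ[𝓝[≠] p] g) : f p = g p :=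
  tendsto_nhds_unique (hf.tendsto.mono_left nhdsWithin_le_nhds)
    ((hg.tendsto.mono_left nhdsWithin_le_nhds).congr' h.symm)

namespace RemovableAt

variable {f g : ℂ → ℂ} {p : ℂ}

theorem of_analyticAt (h : AnalyticAt ℂ f p) : RemovableAt f p := ⟨f, h, EventuallyEq.rfl⟩

theorem congr (hf : RemovableAt f p) (h : g =ᶠ[𝓝[≠] p] f) : RemovableAt g p := by
  obtain ⟨a, ha, hfa⟩ := hf
  exact ⟨a, ha, h.trans hfa⟩

theorem add (hf : RemovableAt f p) (hg : RemovableAt g p) :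
    RemovableAt (fun z => f z + g z) p := by
  obtain ⟨a, ha, hfa⟩ := hf
  obtain ⟨b, hb, hgb⟩ := hg
  exact ⟨_, ha.add hb, hfa.add hgb⟩

theorem const_mul (c : ℂ) (hf : RemovableAt f p) : RemovableAt (fun z => c * f z) p := by
  obtain ⟨a, ha, hfa⟩ := hf
  exact ⟨fun z => c * a z, analyticAt_const.mul ha, hfa.mono fun z hz => by simp only [hz]⟩

theorem sub (hf : RemovableAt f p) (hg : RemovableAt g p) :
    RemovableAt (fun z => f z - g z) p := by
  obtain ⟨a, ha, hfa⟩ := hf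
  obtain ⟨b, hb, hgb⟩ := hg
  exact ⟨_, ha.sub hb, hfa.sub hgb⟩

theorem of_translate {ω c : ℂ} (hq : QuasiPeriodic f ω c) (hf : RemovableAt f (p + ω)) :
    RemovableAt f p := by
  obtain ⟨a, ha, hfa⟩ := hf
  refine ⟨fun z => a (z + ω) - c, ?_, ?_⟩
  · have : AnalyticAt ℂ (fun z : ℂ => z + ω) p := by fun_prop
    exact (AnalyticAt.comp (g := a) (f := fun z : ℂ => z + ω) ha this).sub analyticAt_const
  · filter_upwards [hq p, (tendsto_add_const_nhdsNE p ω).eventually hfa] with z h1 h2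
    rw [← h2, h1]; ring

end RemovableAt

namespace QuasiPeriodic

variable {f g : ℂ → ℂ} {ω c d : ℂ}

theorem of_forall (h : ∀ z, f (z + ω) = f z) : QuasiPeriodic f ω 0 :=
  fun _ => Eventually.of_forall fun z => by simp [h]

theorem add (hf : QuasiPeriodic f ω c) (hg : QuasiPeriodic g ω d) :
    QuasiPeriodic (fun z => f z + g z) ω (c + d) := fun p => by
  filter_upwards [hf p, hg p] with z h1 h2
  rw [h1, h2]; ring

theorem sub (hf : QuasiPeriodic f ω c) (hg : QuasiPeriodic g ω d) :
    QuasiPeriodic (fun z => f z - g z) ω (c - d) := fun p => by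
  filter_upwards [hf p, hg p] with z h1 h2
  rw [h1, h2]; ring

theorem const_mul (k : ℂ) (hf : QuasiPeriodic f ω c) :
    QuasiPeriodic (fun z => k * f z) ω (k * c) := fun p => by
  filter_upwards [hf p] with z h1
  rw [h1]; ring

theorem comp_sub_const (w : ℂ) (hf : QuasiPeriodic f ω c) :
    QuasiPeriodic (fun z => f (z - w)) ω c := fun p => by
  have := (tendsto_add_const_nhdsNE p (-w)).eventually (hf (p + -w))
  filter_upwards [this] with z h1
  rw [show z + ω - w = z + -w + ω by ring, h1, sub_eq_add_neg]

theorem deriv (hf : QuasiPeriodic f ω c) : QuasiPeriodic (deriv f) ω 0 := fun p => by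
  filter_upwards [eventually_nhdsNE_eventually_nhds (hf p)] with z h1
  have h2 : (fun z => f (z + ω)) =ᶠ[𝓝 z] fun z => f z + c := h1
  have := h2.deriv_eq
  rw [deriv_comp_add_const, deriv_add_const] at this
  rw [this, add_zero]

theorem neg (hf : QuasiPeriodic f ω c) : QuasiPeriodic f (-ω) (-c) := fun p => by
  filter_upwards [(tendsto_add_const_nhdsNE p (-ω)).eventually (hf (p + -ω))] with z h1
  rw [neg_add_cancel_right] at h1
  rw [h1]; ring

theorem nat_mul (hf : QuasiPeriodic f ω c) (n : ℕ) : QuasiPeriodic f (n * ω) (n * c) := by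
  induction n with
  | zero => intro p; simp
  | succ n ih =>
    intro p
    filter_upwards [ih p, (tendsto_add_const_nhdsNE p (n * ω)).eventually (hf (p + n * ω))]
      with z h1 h2
    rw [show z + (n + 1 : ℕ) * ω = z + n * ω + ω by push_cast; ring, h2, h1]
    push_cast; ring

theorem int_mul (hf : QuasiPeriodic f ω c) (n : ℤ) : QuasiPeriodic f (n * ω) (n * c) := by
  obtain ⟨k, rfl | rfl⟩ := n.eq_nat_or_neg
  · simpa using hf.nat_mul k
  · simpa using (hf.nat_mul k).neg

end QuasiPeriodic

/-- A function all of whose singularities are removable extends to an entire function. -/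
theorem exists_entire_extension {f : ℂ → ℂ} (hf : ∀ p, RemovableAt f p) :
    ∃ H : ℂ → ℂ, Differentiable ℂ H ∧ ∀ p, f =ᶠ[𝓝[≠] p] H := by
  choose g hg hfg using hf
  have key : ∀ p, (fun z => g z z) =ᶠ[𝓝 p] g p := by
    intro p
    have h1 : ∀ᶠ z in 𝓝[≠] p, g z z = g p z := by
      filter_upwards [eventually_nhdsNE_eventually_nhds (hfg p),
        ((hg p).eventually_analyticAt).filter_mono nhdsWithin_le_nhds] with z hz haz
      exact eq_of_eventuallyEq_nhdsNE (hg z).continuousAt haz.continuousAt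
        ((hfg z).symm.trans (EventuallyEq.filter_mono hz nhdsWithin_le_nhds))
    rw [eventually_nhdsWithin_iff] at h1
    filter_upwards [h1] with z hz
    by_cases hzp : z = p
    · rw [hzp]
    · exact hz hzp
  refine ⟨fun z => g z z, fun p => ?_, fun p => ?_⟩
  · exact (hg p).differentiableAt.congr_of_eventuallyEq (key p)
  · exact (hfg p).trans ((key p).symm.filter_mono nhdsWithin_le_nhds)

/-- Liouville's theorem on the torus: an entire function with periods `π` and `ω`, up to an additive
constant for `ω`, is constant. Its derivative is bounded, hence constant, so the function is affine,
and the period `π` makes its slope vanish. -/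
theorem entire_quasiPeriodic_const {H : ℂ → ℂ} (hH : Differentiable ℂ H) {ω c : ℂ}
    (hω : 0 < ω.im) (h1 : ∀ z, H (z + Real.pi) = H z) (h2 : ∀ z, H (z + ω) = H z + c) :
    ∀ z, H z = H 0 := by
  have d1 : Function.Periodic (deriv H) (Real.pi : ℂ) := fun z => by
    rw [← deriv_comp_add_const]; simp only [h1]
  have d2 : Function.Periodic (deriv H) ω := fun z => by
    rw [← deriv_comp_add_const]; simp only [h2, deriv_add_const]
  have hd : Differentiable ℂ (deriv H) := hH.deriv
  set K : Set ℂ := (fun x : ℝ × ℝ => (x.1 * Real.pi + x.2 * ω : ℂ)) ''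
    (Set.Icc 0 1 ×ˢ Set.Icc 0 1) with hK
  have hKc : IsCompact K := (isCompact_Icc.prod isCompact_Icc).image (by fun_prop)
  have hb : Bornology.IsBounded (Set.range (deriv H)) := by
    refine ((hKc.image hd.continuous).isBounded).subset ?_
    rintro _ ⟨z, rfl⟩
    set b : ℝ := z.im / ω.im with hbdef
    set a : ℝ := (z - b * ω).re / Real.pi with hadef
    have hz : z = a * Real.pi + b * ω := by
      have hpi : Real.pi ≠ 0 := Real.pi_ne_zero
      apply Complex.ext
      · have : a * Real.pi = (z - b * ω).re := div_mul_cancel₀ _ hpi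
        simp at this ⊢
        linarith
      · have : b * ω.im = z.im := div_mul_cancel₀ _ hω.ne'
        simp [this]
    refine ⟨(Int.fract a * Real.pi + Int.fract b * ω : ℂ), ⟨(Int.fract a, Int.fract b),
      ⟨⟨Int.fract_nonneg _, (Int.fract_lt_one _).le⟩, ⟨Int.fract_nonneg _,
        (Int.fract_lt_one _).le⟩⟩, rfl⟩, ?_⟩
    have e : z = (Int.fract a * Real.pi + Int.fract b * ω : ℂ) + ⌊a⌋ * Real.pi + ⌊b⌋ * ω := by
      rw [hz, Int.fract, Int.fract]; push_cast; ring
    conv_rhs => rw [e, d2.int_mul, d1.int_mul]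
  obtain ⟨m, hm⟩ := hd.exists_const_forall_eq_of_bounded hb
  have hlin : ∀ z, H z = m * z + H 0 := by
    have hg : Differentiable ℂ (fun z => H z - m * z) := by fun_prop
    intro z
    have := is_const_of_deriv_eq_zero hg (fun z => by
      have h3 : HasDerivAt (fun z => H z - m * z) (deriv H z - m * 1) z :=
        (hH z).hasDerivAt.sub ((hasDerivAt_id z).const_mul m)
      rw [h3.deriv, hm, mul_one, sub_self]) z 0
    simp at this
    linear_combination this
  have hm0 : m = 0 := by
    have h3 := h1 0
    rw [hlin] at h3
    simpa [Real.pi_ne_zero] using h3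
  intro z
  rw [hlin, hm0]; simp

/-- An elliptic function without poles is constant; the same holds for quasi-periodic functions, so
that the additive constant of quasi-periodicity has to vanish. -/
theorem quasiPeriodic_const {f : ℂ → ℂ} {ω c : ℂ} (hω : 0 < ω.im)
    (hf : ∀ p, RemovableAt f p) (h1 : QuasiPeriodic f Real.pi 0) (h2 : QuasiPeriodic f ω c) :
    c = 0 ∧ ∃ b, ∀ p, ∀ᶠ z in 𝓝[≠] p, f z = b := by
  obtain ⟨H, hH, hfH⟩ := exists_entire_extension hf
  have shift : ∀ w k, QuasiPeriodic f w k → ∀ z, H (z + w) = H z + k := by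
    intro w k hw p
    refine eq_of_eventuallyEq_nhdsNE (f := fun z => H (z + w)) (g := fun z => H z + k)
      (hH.continuous.comp (by fun_prop)).continuousAt
      (hH.continuous.add continuous_const).continuousAt ?_
    filter_upwards [hw p, hfH p, (tendsto_add_const_nhdsNE p w).eventually (hfH (p + w))]
      with z e1 e2 e3
    rw [← e3, e1, e2]
  have hconst := entire_quasiPeriodic_const hH hω (fun z => by simpa using shift _ _ h1 z)
    (shift _ _ h2)
  refine ⟨?_, H 0, fun p => ?_⟩
  · have := shift _ _ h2 0
    rw [hconst] at this
    simpa using this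
  · filter_upwards [hfH p] with z hz
    rw [hz, hconst]

/-! ### Polar parts and Taylor expansions at a point -/

theorem analyticAt_dslope {f : ℂ → ℂ} {p : ℂ} (hf : AnalyticAt ℂ f p) :
    AnalyticAt ℂ (dslope f p) p := by
  obtain ⟨q, hq⟩ := hf
  exact ⟨_, hq.has_fpower_series_dslope_fslope⟩

theorem eq_add_mul_dslope (f : ℂ → ℂ) (p z : ℂ) : f z = f p + (z - p) * dslope f p z := by
  have := sub_smul_dslope f p z
  rw [smul_eq_mul] at this
  rw [this]; ring

/-- A quotient with a simple zero in the denominator has polar part `(N p / D' p) / (z - p)`. -/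
theorem removableAt_div_sub_pole {N D : ℂ → ℂ} {p : ℂ} (hN : AnalyticAt ℂ N p)
    (hD : AnalyticAt ℂ D p) (hp : D p = 0) (hp' : deriv D p ≠ 0) :
    RemovableAt (fun z => N z / D z - N p / deriv D p * (z - p)⁻¹) p := by
  have hd := analyticAt_dslope hD
  have hdp : dslope D p p = deriv D p := dslope_same D p
  have hk : AnalyticAt ℂ (fun z => N z / dslope D p z) p := hN.div hd (by rwa [hdp])
  refine ⟨_, analyticAt_dslope hk, ?_⟩
  filter_upwards [self_mem_nhdsWithin,
    (hd.continuousAt.eventually_ne (by rwa [hdp])).filter_mono nhdsWithin_le_nhds] with z hz hdz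
  have hz' : z - p ≠ 0 := sub_ne_zero.2 hz
  have e1 := eq_add_mul_dslope D p z
  have e2 := eq_add_mul_dslope (fun z => N z / dslope D p z) p z
  simp only [hdp] at e2
  rw [hp, zero_add] at e1
  have e3 : N z / D z = N z / dslope D p z * (z - p)⁻¹ := by
    rw [e1]; field_simp
  rw [e3, e2]
  field_simp
  ring

theorem removableAt_div {N D : ℂ → ℂ} {p : ℂ} (hN : AnalyticAt ℂ N p)
    (hD : AnalyticAt ℂ D p) (hNp : N p = 0) (hp : D p = 0) (hp' : deriv D p ≠ 0) :
    RemovableAt (fun z => N z / D z) p :=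
  (removableAt_div_sub_pole hN hD hp hp').congr (by simp [hNp])

theorem removableAt_deriv_sub_zpow {f : ℂ → ℂ} {c : ℂ} {m : ℤ}
    (hf : RemovableAt (fun z => f z - c * z ^ m) 0) :
    RemovableAt (fun z => deriv f z - c * m * z ^ (m - 1)) 0 := by
  obtain ⟨a, ha, hfa⟩ := hf
  refine ⟨deriv a, ha.deriv, ?_⟩
  filter_upwards [eventually_nhdsNE_eventually_nhds hfa, self_mem_nhdsWithin,
    ha.eventually_analyticAt.filter_mono nhdsWithin_le_nhds] with z hz hz0 haz
  have h1 : HasDerivAt (fun w => c * w ^ m) (c * (m * z ^ (m - 1))) z :=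
    (hasDerivAt_zpow m z (Or.inl hz0)).const_mul c
  have h2 : f =ᶠ[𝓝 z] fun w => a w + c * w ^ m := by
    filter_upwards [hz] with w hw
    rw [← hw]; ring
  rw [h2.deriv_eq, (haz.differentiableAt.hasDerivAt.fun_add h1).deriv]
  ring

/-- `f = a + b z² + c z⁴ + O(z⁵)` at the origin, with analytic remainder. -/
def HasJet (f : ℂ → ℂ) (a b c : ℂ) : Prop :=
  ∃ ψ : ℂ → ℂ, AnalyticAt ℂ ψ 0 ∧ ∀ᶠ z in 𝓝 0, f z = a + b * z ^ 2 + c * z ^ 4 + z ^ 5 * ψ z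

namespace HasJet

variable {f g : ℂ → ℂ} {a b c a' b' c' : ℂ}

theorem analyticAt (h : HasJet f a b c) : AnalyticAt ℂ f 0 := by
  obtain ⟨ψ, hψ, h⟩ := h
  refine AnalyticAt.congr (f := fun z => a + b * z ^ 2 + c * z ^ 4 + z ^ 5 * ψ z) ?_
    (EventuallyEq.symm h)
  fun_prop

theorem apply_zero (h : HasJet f a b c) : f 0 = a := by
  obtain ⟨ψ, hψ, h⟩ := h
  simpa using Filter.Eventually.self_of_nhds h

theorem add (hf : HasJet f a b c) (hg : HasJet g a' b' c') :
    HasJet (fun z => f z + g z) (a + a') (b + b') (c + c') := by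
  obtain ⟨φ, hφ, hf⟩ := hf
  obtain ⟨ψ, hψ, hg⟩ := hg
  refine ⟨fun z => φ z + ψ z, by fun_prop, ?_⟩
  filter_upwards [hf, hg] with z h1 h2
  rw [h1, h2]; ring

theorem mul (hf : HasJet f a b c) (hg : HasJet g a' b' c') :
    HasJet (fun z => f z * g z) (a * a') (a * b' + b * a') (a * c' + b * b' + c * a') := by
  obtain ⟨φ, hφ, hf⟩ := hf
  obtain ⟨ψ, hψ, hg⟩ := hg
  refine ⟨fun z => (b * c' + c * b') * z + c * c' * z ^ 3 +
    (a + b * z ^ 2 + c * z ^ 4) * ψ z + φ z * (a' + b' * z ^ 2 + c' * z ^ 4 + z ^ 5 * ψ z),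
    by fun_prop, ?_⟩
  filter_upwards [hf, hg] with z h1 h2
  rw [h1, h2]; ring

theorem const (k : ℂ) : HasJet (fun _ => k) k 0 0 :=
  ⟨fun _ => 0, analyticAt_const, by simp⟩

theorem const_mul (k : ℂ) (hf : HasJet f a b c) :
    HasJet (fun z => k * f z) (k * a) (k * b) (k * c) := by
  simpa using (const k).mul hf

theorem scale (k : ℂ) (hf : HasJet f a b c) :
    HasJet (fun z => f (k * z)) a (b * k ^ 2) (c * k ^ 4) := by
  obtain ⟨φ, hφ, hf⟩ := hf
  have h0 : AnalyticAt ℂ (fun z : ℂ => k * z) 0 := by fun_prop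
  refine ⟨fun z => k ^ 5 * φ (k * z), analyticAt_const.mul
    (AnalyticAt.comp (g := φ) (f := fun z : ℂ => k * z) (by simpa using hφ) h0), ?_⟩
  have : Tendsto (fun z : ℂ => k * z) (𝓝 0) (𝓝 0) := by
    simpa using h0.continuousAt.tendsto
  filter_upwards [this.eventually hf] with z h1
  rw [h1]; ring

/-- If `U = V (k₀ + k₂ z² + k₄ z⁴) + O(z⁵)`, then `U / (z⁵ V)` has polar part
`k₀ z⁻⁵ + k₂ z⁻³ + k₄ z⁻¹` at the origin. -/
theorem removableAt_div_sub_poles {U V : ℂ → ℂ} {u₀ u₂ u₄ v₀ v₂ v₄ k₀ k₂ k₄ : ℂ}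
    (hU : HasJet U u₀ u₂ u₄) (hV : HasJet V v₀ v₂ v₄) (hv : v₀ ≠ 0) (h₀ : u₀ = v₀ * k₀)
    (h₂ : u₂ = v₀ * k₂ + v₂ * k₀) (h₄ : u₄ = v₀ * k₄ + v₂ * k₂ + v₄ * k₀) :
    RemovableAt (fun z => U z / (z ^ 5 * V z) -
      (k₀ * z ^ (-5 : ℤ) + k₂ * z ^ (-3 : ℤ) + k₄ * z ^ (-1 : ℤ))) 0 := by
  have hV0 := hV.apply_zero
  have hVa := hV.analyticAt
  obtain ⟨φ, hφ, hU⟩ := hU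
  obtain ⟨ψ, hψ, hV⟩ := hV
  refine ⟨fun z => (φ z - ψ z * (k₀ + k₂ * z ^ 2 + k₄ * z ^ 4) - (v₂ * k₄ + v₄ * k₂) * z
    - v₄ * k₄ * z ^ 3) / V z, ?_, ?_⟩
  · exact AnalyticAt.div (by fun_prop) hVa (by rwa [hV0])
  · filter_upwards [self_mem_nhdsWithin, hU.filter_mono nhdsWithin_le_nhds,
      hV.filter_mono nhdsWithin_le_nhds, (hVa.continuousAt.eventually_ne
      (by rwa [hV0])).filter_mono nhdsWithin_le_nhds] with z hz h1 h2 h3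
    have hz : z ≠ 0 := hz
    have e1 : k₀ * z ^ (-5 : ℤ) + k₂ * z ^ (-3 : ℤ) + k₄ * z ^ (-1 : ℤ) =
        V z * (k₀ + k₂ * z ^ 2 + k₄ * z ^ 4) / (z ^ 5 * V z) := by
      have e5 : z ^ (-5 : ℤ) = (z ^ 5)⁻¹ := zpow_neg z 5
      have e3 : z ^ (-3 : ℤ) = (z ^ 3)⁻¹ := zpow_neg z 3
      rw [e5, e3, zpow_neg_one]
      field_simp
    rw [e1, ← sub_div, div_eq_div_iff (mul_ne_zero (pow_ne_zero _ hz) h3) h3]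
    rw [show U z - V z * (k₀ + k₂ * z ^ 2 + k₄ * z ^ 4) = z ^ 5 * (φ z -
      ψ z * (k₀ + k₂ * z ^ 2 + k₄ * z ^ 4) - (v₂ * k₄ + v₄ * k₂) * z - v₄ * k₄ * z ^ 3) by
        rw [h1, h2, h₀, h₂, h₄]; ring]
    ring

theorem sq_mul (hf : HasJet f a b c) : HasJet (fun z => z ^ 2 * f z) 0 a b := by
  obtain ⟨φ, hφ, hf⟩ := hf
  refine ⟨fun z => c * z + z ^ 2 * φ z, by fun_prop, ?_⟩
  filter_upwards [hf] with z h1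
  rw [h1]; ring

theorem of_pow_mul {φ : ℂ → ℂ} (hφ : AnalyticAt ℂ φ 0) : HasJet (fun z => z ^ 5 * φ z) 0 0 0 :=
  ⟨φ, hφ, by simp⟩

end HasJet

/-- The jet of `sin z / z`, given as a factor so as to avoid the value of the quotient at `0`. -/
theorem exists_sin_eq_mul_hasJet :
    ∃ s : ℂ → ℂ, HasJet s 1 (-1 / 6) (1 / 120) ∧ ∀ z, sin z = z * s z := by
  obtain ⟨χ, hχ, hs⟩ := (analyticAt_sin (x := (0 : ℂ))).exists_eq_sum_add_pow_mul 6
  refine ⟨fun z => 1 + -1 / 6 * z ^ 2 + 1 / 120 * z ^ 4 + z ^ 5 * χ z,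
    ⟨χ, hχ, Eventually.of_forall fun _ => rfl⟩, fun z => ?_⟩
  rw [hs z]
  simp [Finset.sum_range_succ, iteratedDeriv_succ, iteratedDeriv_zero, Nat.factorial]
  ring

/-- The jet of `F (sin² z)`, from the Taylor polynomial of `F` of degree two. -/
theorem hasJet_comp_sin_sq {F : ℂ → ℂ} (hF : AnalyticAt ℂ F 0) :
    HasJet (fun z => F (sin z ^ 2)) (F 0) (deriv F 0)
      (iteratedDeriv 2 F 0 / 2 - deriv F 0 / 3) := by
  obtain ⟨φ, hφ, h⟩ := hF.exists_eq_sum_add_pow_mul 3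
  obtain ⟨s, hs, hsin⟩ := exists_sin_eq_mul_hasJet
  have hφs : AnalyticAt ℂ (fun z => φ (sin z ^ 2)) 0 :=
    AnalyticAt.comp (g := φ) (f := fun z => sin z ^ 2) (by simpa using hφ) (by fun_prop)
  have hsa := hs.analyticAt
  have hr : AnalyticAt ℂ (fun z => z * s z ^ 6 * φ (sin z ^ 2)) 0 :=
    AnalyticAt.mul (by fun_prop) hφs
  have h2 := hs.mul hs
  have key := (((HasJet.const (F 0)).add (h2.sq_mul.const_mul (deriv F 0))).add
    ((h2.mul h2).sq_mul.sq_mul.const_mul (iteratedDeriv 2 F 0 / 2))).add (HasJet.of_pow_mul hr)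
  have heq : (fun z => F (sin z ^ 2)) = fun z => F 0 + deriv F 0 * (z ^ 2 * (s z * s z)) +
      iteratedDeriv 2 F 0 / 2 * (z ^ 2 * (z ^ 2 * (s z * s z * (s z * s z)))) +
      z ^ 5 * (z * s z ^ 6 * φ (sin z ^ 2)) := by
    funext z
    have h1 := h (sin z ^ 2)
    simp only [Finset.sum_range_succ, Finset.sum_range_zero, iteratedDeriv_zero, iteratedDeriv_one,
      Nat.factorial, smul_eq_mul] at h1
    rw [h1]
    generalize φ (sin z ^ 2) = P
    rw [hsin z]
    push_cast
    ring
  rw [heq]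
  convert key using 1 <;> ring

/-! ### Quasi-periodicity and special values of `θ₁` -/

section

theorem neg_exp (w : ℂ) : -exp w = exp (Real.pi * I + w) := by
  rw [exp_add, exp_pi_mul_I, neg_one_mul]

theorem I_mul_exp (w : ℂ) : I * exp w = exp (Real.pi / 2 * I + w) := by
  rw [exp_add, exp_pi_div_two_mul_I]

theorem theta1_eq_jacobiTheta₂ (z τ : ℂ) :
    theta1 z τ =
      -I * qPow τ (1 / 8) * exp (I * z) * jacobiTheta₂ (z / Real.pi + τ / 2 + 1 / 2) τ := by
  have hpi : (Real.pi : ℂ) ≠ 0 := by exact_mod_cast Real.pi_ne_zero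
  rw [theta1, jacobiTheta₂, mul_assoc (-I * qPow τ (1 / 8)), ← tsum_mul_left (a := exp (I * z))]
  congr 2
  funext n
  rw [jacobiTheta₂_term, qPow, ← exp_pi_mul_I, ← exp_int_mul, ← exp_add, ← exp_add, ← exp_add]
  congr 1
  field_simp
  ring

variable {τ : ℂ}

theorem differentiable_theta1 (hτ : 0 < τ.im) : Differentiable ℂ fun z => theta1 z τ := by
  intro z
  simp only [theta1_eq_jacobiTheta₂]
  have h := differentiableAt_jacobiTheta₂_fst (z / Real.pi + τ / 2 + 1 / 2) hτ
  have h2 : DifferentiableAt ℂ (fun z : ℂ => z / Real.pi + τ / 2 + 1 / 2) z := by fun_prop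
  exact DifferentiableAt.mul (by fun_prop)
    (DifferentiableAt.comp (g := fun w => jacobiTheta₂ w τ) z h h2)

theorem theta1_add_pi (z τ : ℂ) : theta1 (z + Real.pi) τ = -theta1 z τ := by
  have hpi : (Real.pi : ℂ) ≠ 0 := by exact_mod_cast Real.pi_ne_zero
  rw [theta1_eq_jacobiTheta₂, theta1_eq_jacobiTheta₂,
    show (z + Real.pi) / Real.pi + τ / 2 + 1 / 2 = z / Real.pi + τ / 2 + 1 / 2 + 1 by
      field_simp; ring, jacobiTheta₂_add_left, mul_add, exp_add, mul_comm I (Real.pi : ℂ),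
    exp_pi_mul_I]
  ring

theorem theta1_add_pi_mul (z τ : ℂ) :
    theta1 (z + Real.pi * τ) τ = -exp (-(Real.pi * I * τ) - 2 * I * z) * theta1 z τ := by
  have hpi : (Real.pi : ℂ) ≠ 0 := by exact_mod_cast Real.pi_ne_zero
  rw [theta1_eq_jacobiTheta₂, theta1_eq_jacobiTheta₂,
    show (z + Real.pi * τ) / Real.pi + τ / 2 + 1 / 2 = z / Real.pi + τ / 2 + 1 / 2 + τ by
      field_simp; ring, jacobiTheta₂_add_left']
  have h : exp (I * (z + Real.pi * τ)) *
      exp (-(Real.pi : ℂ) * I * (τ + 2 * (z / Real.pi + τ / 2 + 1 / 2))) =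
      -exp (-(Real.pi * I * τ) - 2 * I * z) * exp (I * z) := by
    rw [neg_mul (exp _), ← exp_add, ← exp_add, neg_exp, exp_eq_exp_iff_exists_int]
    refine ⟨-1, ?_⟩
    push_cast
    field_simp
    ring
  linear_combination (-I * qPow τ (1 / 8) * jacobiTheta₂ (z / Real.pi + τ / 2 + 1 / 2) τ) * h

theorem theta1_add_four_pi_mul (z τ : ℂ) :
    theta1 (z + 4 * (Real.pi * τ)) τ =
      exp (-(16 * (Real.pi * I * τ)) - 8 * I * z) * theta1 z τ := by
  rw [show z + 4 * (Real.pi * τ) =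
    z + Real.pi * τ + Real.pi * τ + Real.pi * τ + Real.pi * τ by ring]
  simp only [theta1_add_pi_mul, ← mul_assoc, neg_mul_neg, ← exp_add]
  ring_nf

/-- The point `τ / 2 + 1 / 2` is congruent to its negative, and the multiplier relating the two
values of the even function `jacobiTheta₂` is `-1`. -/
theorem theta1_zero (τ : ℂ) : theta1 0 τ = 0 := by
  have h : jacobiTheta₂ (τ / 2 + 1 / 2) τ = -jacobiTheta₂ (τ / 2 + 1 / 2) τ := by
    conv_lhs => rw [show τ / 2 + 1 / 2 = -(τ / 2 + 1 / 2) + τ + 1 by ring,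
      jacobiTheta₂_add_left, jacobiTheta₂_add_left', jacobiTheta₂_neg_left,
      show -(Real.pi : ℂ) * I * (τ + 2 * -(τ / 2 + 1 / 2)) = Real.pi * I by ring, exp_pi_mul_I]
    ring
  have h0 : jacobiTheta₂ (τ / 2 + 1 / 2) τ = 0 := by linear_combination h / 2
  rw [theta1_eq_jacobiTheta₂]
  have h1 : (0 : ℂ) / Real.pi + τ / 2 + 1 / 2 = τ / 2 + 1 / 2 := by ring
  rw [h1, h0, mul_zero]

/-- Integrating the series over a period isolates the term of index `0`, which is `1`. -/
theorem exists_jacobiTheta₂_ne_zero (hτ : 0 < τ.im) : ∃ z, jacobiTheta₂ z τ ≠ 0 := by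
  by_contra! hz
  have hpi : (Real.pi : ℂ) ≠ 0 := by exact_mod_cast Real.pi_ne_zero
  have hs : HasSum (fun n : ℤ => ∫ x in (0 : ℝ)..1, jacobiTheta₂_term n x τ)
      (∫ x in (0 : ℝ)..1, jacobiTheta₂ x τ) := by
    refine intervalIntegral.hasSum_integral_of_dominated_convergence
      (fun n _ => ‖jacobiTheta₂_term n 0 τ‖) ?_ ?_ ?_ ?_ ?_
    · intro n
      exact Continuous.aestronglyMeasurable (by unfold jacobiTheta₂_term; fun_prop)
    · intro n
      exact Eventually.of_forall fun x _ => by simp [norm_jacobiTheta₂_term]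
    · exact Eventually.of_forall fun x _ => ((summable_jacobiTheta₂_term_iff 0 τ).2 hτ).norm
    · simp
    · exact Eventually.of_forall fun x _ => hasSum_jacobiTheta₂_term x hτ
  have h1 : ∀ n : ℤ, n ≠ 0 → ∫ x in (0 : ℝ)..1, jacobiTheta₂_term n x τ = 0 := by
    intro n hn
    have hc : 2 * Real.pi * I * n ≠ 0 := by
      simp [hn, I_ne_zero, hpi]
    have : ∀ x : ℝ, jacobiTheta₂_term n x τ =
        exp (Real.pi * I * n ^ 2 * τ) * exp (2 * Real.pi * I * n * x) := fun x => by
      rw [jacobiTheta₂_term, exp_add, mul_comm]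
    simp only [this]
    rw [intervalIntegral.integral_const_mul, integral_exp_mul_complex hc]
    have : exp (2 * Real.pi * I * n) = 1 := by
      rw [show 2 * Real.pi * I * n = n * (2 * Real.pi * I) by ring, exp_int_mul_two_pi_mul_I]
    simp [this]
  have h2 := hs.tsum_eq
  rw [tsum_eq_single 0 h1] at h2
  simp [hz, jacobiTheta₂_term] at h2

theorem exists_theta1_ne_zero (hτ : 0 < τ.im) : ∃ z, theta1 z τ ≠ 0 := by
  have hpi : (Real.pi : ℂ) ≠ 0 := by exact_mod_cast Real.pi_ne_zero
  obtain ⟨w, hw⟩ := exists_jacobiTheta₂_ne_zero hτ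
  refine ⟨Real.pi * (w - τ / 2 - 1 / 2), ?_⟩
  rw [theta1_eq_jacobiTheta₂, show Real.pi * (w - τ / 2 - 1 / 2) / Real.pi + τ / 2 + 1 / 2 = w by
    field_simp; ring]
  simp [hw, qPow]

theorem vartheta3_eq_jacobiTheta₂ (hτ : 0 < τ.im) : vartheta3 τ = jacobiTheta₂ 0 τ := by
  rw [vartheta3, theta3, jacobiTheta₂, tsum_int_eq_zero_add_two_mul_tsum_pnat
    (fun n => by simp [jacobiTheta₂_term]) ((summable_jacobiTheta₂_term_iff 0 τ).2 hτ)]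
  rw [nsmul_eq_mul]
  congr 1
  · simp [jacobiTheta₂_term]
  · congr 1
    refine tsum_congr fun n => ?_
    simp [jacobiTheta₂_term, qPow]
    ring_nf

theorem vartheta4_eq_jacobiTheta₂ (hτ : 0 < τ.im) : vartheta4 τ = jacobiTheta₂ (1 / 2) τ := by
  have ht : ∀ n : ℤ, jacobiTheta₂_term n (1 / 2) τ = (-1) ^ n * exp (Real.pi * I * n ^ 2 * τ) := by
    intro n
    rw [jacobiTheta₂_term, exp_add, ← exp_pi_mul_I, ← exp_int_mul]
    ring_nf
  rw [vartheta4, theta4, jacobiTheta₂, tsum_int_eq_zero_add_two_mul_tsum_pnat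
    (fun n => by rw [ht, ht]; simp [← inv_zpow]) ((summable_jacobiTheta₂_term_iff _ τ).2 hτ)]
  rw [nsmul_eq_mul]
  congr 1
  · simp [jacobiTheta₂_term]
  · congr 1
    refine tsum_congr fun n => ?_
    rw [ht]
    simp [qPow]
    ring_nf

theorem vartheta2_eq_jacobiTheta₂ (hτ : 0 < τ.im) :
    vartheta2 τ = qPow τ (1 / 8) * jacobiTheta₂ (τ / 2) τ := by
  have hs := (summable_jacobiTheta₂_term_iff (τ / 2) τ).2 hτ
  have ht : ∀ n : ℤ, jacobiTheta₂_term (-(n + 1)) (τ / 2) τ = jacobiTheta₂_term n (τ / 2) τ := by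
    intro n
    simp only [jacobiTheta₂_term]
    push_cast
    ring_nf
  have hs1 : Summable fun n : ℕ => jacobiTheta₂_term n (τ / 2) τ :=
    hs.comp_injective Nat.cast_injective
  have h2 : jacobiTheta₂ (τ / 2) τ = 2 * ∑' n : ℕ, jacobiTheta₂_term n (τ / 2) τ := by
    rw [jacobiTheta₂, tsum_of_nat_of_neg_add_one (f := fun n : ℤ => jacobiTheta₂_term n (τ / 2) τ)
      hs1 (by simpa only [ht] using hs1), two_mul]
    simp only [ht]
  rw [vartheta2, theta2, h2, mul_left_comm, ← tsum_mul_left (a := qPow τ (1 / 8))]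
  congr 1
  refine tsum_congr fun n => ?_
  rw [mul_zero, cos_zero, mul_one, jacobiTheta₂_term, qPow, qPow, ← exp_add]
  congr 1
  push_cast
  ring

theorem theta1_pi_div_two (hτ : 0 < τ.im) : theta1 (Real.pi / 2) τ = vartheta2 τ := by
  have hpi : (Real.pi : ℂ) ≠ 0 := by exact_mod_cast Real.pi_ne_zero
  rw [theta1_eq_jacobiTheta₂, vartheta2_eq_jacobiTheta₂ hτ,
    show (Real.pi : ℂ) / 2 / Real.pi + τ / 2 + 1 / 2 = τ / 2 + 1 by field_simp; ring,
    jacobiTheta₂_add_left, mul_comm I, exp_pi_div_two_mul_I]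
  linear_combination (-(qPow τ (1 / 8) * jacobiTheta₂ (τ / 2) τ)) * I_mul_I

theorem theta1_pi_mul_div_two (hτ : 0 < τ.im) :
    theta1 (Real.pi * τ / 2) τ = I * exp (-(Real.pi * I * τ) / 4) * vartheta4 τ := by
  have hpi : (Real.pi : ℂ) ≠ 0 := by exact_mod_cast Real.pi_ne_zero
  rw [theta1_eq_jacobiTheta₂, vartheta4_eq_jacobiTheta₂ hτ,
    show (Real.pi : ℂ) * τ / 2 / Real.pi + τ / 2 + 1 / 2 = 1 / 2 + τ by field_simp; ring,
    jacobiTheta₂_add_left', qPow]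
  have h : exp (2 * Real.pi * I * (1 / 8) * τ) * exp (I * (Real.pi * τ / 2)) *
      exp (-(Real.pi : ℂ) * I * (τ + 2 * (1 / 2))) = -exp (-(Real.pi * I * τ) / 4) := by
    rw [neg_exp, ← exp_add, ← exp_add, exp_eq_exp_iff_exists_int]
    refine ⟨-1, ?_⟩
    push_cast
    ring
  linear_combination (-I * jacobiTheta₂ (1 / 2) τ) * h

theorem theta1_pi_add_pi_mul_div_two (hτ : 0 < τ.im) :
    theta1 (Real.pi / 2 + Real.pi * τ / 2) τ = exp (-(Real.pi * I * τ) / 4) * vartheta3 τ := by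
  have hpi : (Real.pi : ℂ) ≠ 0 := by exact_mod_cast Real.pi_ne_zero
  rw [theta1_eq_jacobiTheta₂, vartheta3_eq_jacobiTheta₂ hτ,
    show ((Real.pi : ℂ) / 2 + Real.pi * τ / 2) / Real.pi + τ / 2 + 1 / 2 = 0 + τ + 1 by
      field_simp; ring,
    jacobiTheta₂_add_left, jacobiTheta₂_add_left', qPow]
  have h : exp (2 * Real.pi * I * (1 / 8) * τ) * exp (I * (Real.pi / 2 + Real.pi * τ / 2)) *
      exp (-(Real.pi : ℂ) * I * (τ + 2 * 0)) = I * exp (-(Real.pi * I * τ) / 4) := by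
    rw [I_mul_exp, ← exp_add, ← exp_add]
    ring_nf
  linear_combination (-I * jacobiTheta₂ 0 τ) * h -
    exp (-(Real.pi * I * τ) / 4) * jacobiTheta₂ 0 τ * I_mul_I

end

/-! ### Infinite products and Lambert series -/

section GenusZero

variable {a : ℕ → ℂ}

theorem hasProdLocallyUniformlyOn_one_add_mul (ha : Summable fun n => ‖a n‖) (R : ℝ) :
    HasProdLocallyUniformlyOn (fun n s => 1 + a n * s) (fun s => ∏' n, (1 + a n * s))
      (Metric.ball (0 : ℂ) R) := by
  refine Summable.hasProdLocallyUniformlyOn_nat_one_add (f := fun n s => a n * s)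
    (u := fun n => ‖a n‖ * R) Metric.isOpen_ball (ha.mul_right R) ?_ (fun n => by fun_prop)
  refine Eventually.of_forall fun n x hx => ?_
  rw [norm_mul]
  exact mul_le_mul_of_nonneg_left (by simpa using (Metric.mem_ball.1 hx).le) (norm_nonneg _)

theorem differentiable_tprod_one_add_mul (ha : Summable fun n => ‖a n‖) :
    Differentiable ℂ fun s => ∏' n, (1 + a n * s) := by
  intro s
  have hs : s ∈ Metric.ball (0 : ℂ) (‖s‖ + 1) := by simp
  refine DifferentiableOn.differentiableAt (s := Metric.ball (0 : ℂ) (‖s‖ + 1)) ?_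
    (Metric.isOpen_ball.mem_nhds hs)
  refine (hasProdLocallyUniformlyOn_one_add_mul ha _).differentiableOn
    (Eventually.of_forall fun t => ?_) Metric.isOpen_ball
  simpa [Finset.prod_fn] using DifferentiableOn.finsetProd (fun _ _ => by fun_prop)

/-- The first two derivatives at the origin of `∏ (1 + aₙ s)`, by Newton's identity for the power
sums of the `aₙ`. -/
theorem deriv_tprod_one_add_mul (ha : Summable fun n => ‖a n‖) :
    deriv (fun s => ∏' n, (1 + a n * s)) 0 = ∑' n, a n ∧
    iteratedDeriv 2 (fun s => ∏' n, (1 + a n * s)) 0 = (∑' n, a n) ^ 2 - ∑' n, a n ^ 2 := by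
  set F : ℂ → ℂ := fun s => ∏' n, (1 + a n * s) with hF
  set B : ℝ := ∑' n, ‖a n‖ + 1 with hB
  have hB0 : 0 < B := by
    have : 0 ≤ ∑' n, ‖a n‖ := tsum_nonneg fun n => norm_nonneg _
    linarith
  have haB : ∀ n, ‖a n‖ ≤ B := fun n => by
    have := ha.le_tsum n (fun _ _ => norm_nonneg _)
    linarith
  set r : ℝ := (2 * B)⁻¹ with hr
  have hr0 : 0 < r := by positivity
  -- On the ball of radius `r` each factor stays at distance at least `1 / 2` from `0`.
  have hlow : ∀ n, ∀ x ∈ Metric.ball (0 : ℂ) r, 1 / 2 ≤ ‖1 + a n * x‖ := by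
    intro n x hx
    have h1 : ‖a n * x‖ ≤ 1 / 2 := by
      rw [norm_mul]
      calc ‖a n‖ * ‖x‖ ≤ B * r := by
            refine mul_le_mul (haB n) (by simpa using (Metric.mem_ball.1 hx).le) (norm_nonneg _)
              hB0.le
        _ = 1 / 2 := by rw [hr]; field_simp
    have h2 := norm_sub_le (1 + a n * x) (a n * x)
    rw [add_sub_cancel_right, norm_one] at h2
    linarith
  have hne : ∀ n, ∀ x ∈ Metric.ball (0 : ℂ) r, 1 + a n * x ≠ 0 := fun n x hx h => by
    have := hlow n x hx
    rw [h, norm_zero] at this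
    linarith
  have hld : ∀ n x, logDeriv (fun s => 1 + a n * s) x = a n / (1 + a n * x) := fun n x => by
    have h : HasDerivAt (fun s => 1 + a n * s) (a n * 1) x :=
      ((hasDerivAt_id x).const_mul (a n)).const_add 1
    rw [logDeriv_apply, h.deriv, mul_one]
  have hsum : ∀ x ∈ Metric.ball (0 : ℂ) r, Summable fun n => a n / (1 + a n * x) := by
    intro x hx
    refine Summable.of_norm_bounded (g := fun n => 2 * ‖a n‖) (ha.mul_left 2) fun n => ?_
    have h1 := hlow n x hx
    rw [norm_div, div_le_iff₀ (by linarith)]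
    nlinarith [norm_nonneg (a n)]
  set G : ℂ → ℂ := fun x => ∑' n, a n / (1 + a n * x) with hG
  have hFd := differentiable_tprod_one_add_mul ha
  have hFne : ∀ x ∈ Metric.ball (0 : ℂ) r, F x ≠ 0 := by
    intro x hx
    refine tprod_one_add_ne_zero_of_summable (fun n => hne n x hx) ?_
    simpa [norm_mul] using ha.mul_right ‖x‖
  have hderiv : ∀ x ∈ Metric.ball (0 : ℂ) r, deriv F x = F x * G x := by
    intro x hx
    have h := logDeriv_tprod_eq_tsum (f := fun n s => 1 + a n * s) Metric.isOpen_ball hx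
      (fun n => hne n x hx) (fun n => by fun_prop) (by simpa only [hld] using hsum x hx)
      (hasProdLocallyUniformlyOn_one_add_mul ha r).multipliableLocallyUniformlyOn (hFne x hx)
    simp only [hld] at h
    rw [logDeriv_apply, div_eq_iff (hFne x hx)] at h
    rw [mul_comm]
    exact h
  have h0 : (0 : ℂ) ∈ Metric.ball (0 : ℂ) r := Metric.mem_ball_self hr0
  have hG' : HasDerivAt G (∑' n, -(a n ^ 2) / (1 + a n * 0) ^ 2) 0 := by
    refine hasDerivAt_tsum_of_isPreconnected (g := fun n x => a n / (1 + a n * x))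
      (g' := fun n x => -(a n ^ 2) / (1 + a n * x) ^ 2) (u := fun n => 4 * (‖a n‖ * B))
      ((ha.mul_right B).mul_left 4) Metric.isOpen_ball
      (convex_ball (0 : ℂ) r).isPreconnected ?_ ?_ h0 (hsum 0 h0) h0
    · intro n y hy
      have h : HasDerivAt (fun s => 1 + a n * s) (a n * 1) y :=
        ((hasDerivAt_id y).const_mul (a n)).const_add 1
      have h2 := (hasDerivAt_const y (a n)).fun_div h (hne n y hy)
      exact h2.congr_deriv (by ring)
    · intro n y hy
      have h1 := hlow n y hy
      have h2 : 1 / 4 ≤ ‖1 + a n * y‖ ^ 2 := by nlinarith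
      rw [norm_div, norm_neg, norm_pow, norm_pow, div_le_iff₀ (by linarith)]
      have h3 : ‖a n‖ ^ 2 ≤ ‖a n‖ * B := by
        rw [pow_two]; exact mul_le_mul_of_nonneg_left (haB n) (norm_nonneg _)
      nlinarith [mul_nonneg (norm_nonneg (a n)) hB0.le]
  have hF0 : F 0 = 1 := by simp [hF]
  have hG0 : G 0 = ∑' n, a n := by simp [hG]
  have hd0 : deriv F 0 = ∑' n, a n := by rw [hderiv 0 h0, hF0, hG0, one_mul]
  refine ⟨hd0, ?_⟩
  have hev : deriv F =ᶠ[𝓝 0] fun x => F x * G x :=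
    eventually_of_mem (Metric.isOpen_ball.mem_nhds h0) hderiv
  rw [iteratedDeriv_succ, iteratedDeriv_one, hev.deriv_eq,
    ((hFd 0).hasDerivAt.fun_mul hG').deriv, hd0, hG0,
    show (∏' n, (1 + a n * (0 : ℂ))) = 1 from hF0]
  simp only [mul_zero, add_zero, one_pow, div_one, tsum_neg, one_mul]
  ring

end GenusZero

section Lambert

variable {q : ℂ}

theorem hasSum_cube_mul_geometric {r : ℂ} (hr : ‖r‖ < 1) :
    HasSum (fun n : ℕ => (n : ℂ) ^ 3 * r ^ n) (6 * (r / (1 - r) ^ 2) ^ 2 + r / (1 - r) ^ 2) := by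
  have h1 := (hasSum_choose_mul_geometric_of_norm_lt_one 3 hr).mul_left (6 * r ^ 2)
  have h2 := hasSum_coe_mul_geometric_of_norm_lt_one hr
  have h3 : HasSum (fun n : ℕ => ((n : ℂ) ^ 3 - n) * r ^ n) (6 * (r / (1 - r) ^ 2) ^ 2) := by
    refine (hasSum_nat_add_iff' 2).1 ?_
    have e1 : (6 * (r / (1 - r) ^ 2) ^ 2) - ∑ i ∈ Finset.range 2, ((i : ℂ) ^ 3 - i) * r ^ i =
        6 * r ^ 2 * (1 / (1 - r) ^ (3 + 1)) := by
      rw [div_pow, ← pow_mul, mul_one_div, mul_div_assoc]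
      simp [Finset.sum_range_succ]
    rw [e1]
    refine h1.congr_fun fun n => ?_
    have h4 : ((n + 3).choose 3 : ℂ) * 6 = (n + 1) * (n + 2) * (n + 3) := by
      have h5 := Nat.descFactorial_eq_factorial_mul_choose (n + 3) 3
      have h6 : (n + 3).descFactorial 3 = (n + 1) * (n + 2) * (n + 3) := by
        simp [Nat.descFactorial]; ring
      rw [h6] at h5
      have h7 : ((3).factorial : ℂ) = 6 := by norm_num [Nat.factorial]
      have := congrArg (Nat.cast (R := ℂ)) h5
      push_cast [h7] at this
      rw [this]; ring
    push_cast
    linear_combination (-(r ^ 2 * r ^ n)) * h4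
  exact (h3.add h2).congr_fun fun n => by ring

/-- Expanding both sides as double series `∑ cᵏ q^(dc)`. -/
theorem tsum_pow_div_one_sub_eq_tsum_tsum (hq : ‖q‖ < 1) (k : ℕ) :
    ∑' n : ℕ+, (n : ℂ) ^ k * q ^ (n : ℕ) / (1 - q ^ (n : ℕ)) =
      ∑' d : ℕ+, ∑' c : ℕ+, (c : ℂ) ^ k * (q ^ (d : ℕ)) ^ (c : ℕ) := by
  rw [tsum_pow_div_one_sub_eq_tsum_sigma hq, ← tsum_prod_pow_eq_tsum_sigma k hq]
  simp only [pow_mul]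

theorem norm_pow_pnat_lt_one (hq : ‖q‖ < 1) (d : ℕ+) : ‖q ^ (d : ℕ)‖ < 1 := by
  rw [norm_pow]
  exact pow_lt_one₀ (norm_nonneg _) hq d.ne_zero

theorem tsum_pnat_pow_mul_pow {k : ℕ} (hk : k ≠ 0) (r : ℂ) :
    ∑' c : ℕ+, (c : ℂ) ^ k * r ^ (c : ℕ) = ∑' c : ℕ, (c : ℂ) ^ k * r ^ c :=
  tsum_pnat_eq_tsum_of_eq_zero (f := fun c : ℕ => (c : ℂ) ^ k * r ^ c) (by simp [hk])

theorem tsum_lambert_one (hq : ‖q‖ < 1) :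
    ∑' n : ℕ+, (n : ℂ) * q ^ (n : ℕ) / (1 - q ^ (n : ℕ)) =
      ∑' d : ℕ+, q ^ (d : ℕ) / (1 - q ^ (d : ℕ)) ^ 2 := by
  have h := tsum_pow_div_one_sub_eq_tsum_tsum hq 1
  simp only [pow_one] at h
  rw [h]
  refine tsum_congr fun d => ?_
  have h2 := tsum_pnat_pow_mul_pow one_ne_zero (q ^ (d : ℕ))
  simp only [pow_one] at h2
  rw [h2, tsum_coe_mul_geometric_of_norm_lt_one (norm_pow_pnat_lt_one hq d)]

theorem tsum_lambert_three (hq : ‖q‖ < 1) :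
    ∑' n : ℕ+, (n : ℂ) ^ 3 * q ^ (n : ℕ) / (1 - q ^ (n : ℕ)) =
      ∑' d : ℕ+, (6 * (q ^ (d : ℕ) / (1 - q ^ (d : ℕ)) ^ 2) ^ 2 +
        q ^ (d : ℕ) / (1 - q ^ (d : ℕ)) ^ 2) := by
  rw [tsum_pow_div_one_sub_eq_tsum_tsum hq 3]
  refine tsum_congr fun d => ?_
  rw [tsum_pnat_pow_mul_pow three_ne_zero,
    (hasSum_cube_mul_geometric (norm_pow_pnat_lt_one hq d)).tsum_eq]

/-- The coefficients of the factors `1 + aₙ sin² z` of `θ₁`; the index is shifted so that `n`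
belongs to `q ^ (n + 1)`. -/
noncomputable def sinCoeff (q : ℂ) (n : ℕ) : ℂ := 4 * q ^ (n + 1) / (1 - q ^ (n + 1)) ^ 2

theorem norm_pow_succ_lt_one (hq : ‖q‖ < 1) (n : ℕ) : ‖q ^ (n + 1)‖ < 1 := by
  rw [norm_pow]
  exact pow_lt_one₀ (norm_nonneg _) hq n.succ_ne_zero

theorem one_sub_pow_succ_ne_zero (hq : ‖q‖ < 1) (n : ℕ) : 1 - q ^ (n + 1) ≠ 0 := by
  intro h
  have := norm_pow_succ_lt_one hq n
  rw [← sub_eq_zero.1 h, norm_one] at this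
  exact lt_irrefl _ this

theorem summable_norm_sinCoeff (hq : ‖q‖ < 1) : Summable fun n => ‖sinCoeff q n‖ := by
  have h0 : 0 < 1 - ‖q‖ := by linarith
  refine Summable.of_nonneg_of_le (fun n => norm_nonneg _)
    (f := fun n : ℕ => 4 * ‖q‖ / (1 - ‖q‖) ^ 2 * ‖q‖ ^ n) (fun n => ?_)
    ((summable_geometric_of_lt_one (norm_nonneg _) hq).mul_left _)
  have h1 : 1 - ‖q‖ ≤ ‖1 - q ^ (n + 1)‖ := by
    have h2 := norm_sub_norm_le 1 (q ^ (n + 1))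
    have h3 : ‖q ^ (n + 1)‖ ≤ ‖q‖ := by
      rw [norm_pow]; exact pow_le_of_le_one (norm_nonneg _) hq.le n.succ_ne_zero
    rw [norm_one] at h2
    linarith
  rw [sinCoeff, norm_div, norm_mul, norm_pow, norm_pow, div_mul_eq_mul_div]
  have h4 : ‖(4 : ℂ)‖ = 4 := by simp
  rw [h4]
  calc 4 * ‖q‖ ^ (n + 1) / ‖1 - q ^ (n + 1)‖ ^ 2
      ≤ 4 * ‖q‖ ^ (n + 1) / (1 - ‖q‖) ^ 2 := by gcongr
    _ = 4 * ‖q‖ * ‖q‖ ^ n / (1 - ‖q‖) ^ 2 := by ring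

theorem tsum_sinCoeff (hq : ‖q‖ < 1) :
    ∑' n, sinCoeff q n =
      4 * ∑' n : ℕ+, (n : ℂ) * q ^ (n : ℕ) / (1 - q ^ (n : ℕ)) := by
  rw [tsum_lambert_one hq,
    tsum_pnat_eq_tsum_succ (f := fun d : ℕ => q ^ d / (1 - q ^ d) ^ 2), ← tsum_mul_left]
  exact tsum_congr fun n => by rw [sinCoeff]; ring

theorem tsum_sinCoeff_sq (hq : ‖q‖ < 1) :
    ∑' n, sinCoeff q n ^ 2 =
      8 / 3 * (∑' n : ℕ+, (n : ℂ) ^ 3 * q ^ (n : ℕ) / (1 - q ^ (n : ℕ)) -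
        ∑' n : ℕ+, (n : ℂ) * q ^ (n : ℕ) / (1 - q ^ (n : ℕ))) := by
  have hs : Summable fun n => ‖sinCoeff q n‖ := summable_norm_sinCoeff hq
  have hs2 : Summable fun n => sinCoeff q n ^ 2 := by
    refine Summable.of_norm ?_
    simp only [norm_pow]
    refine Summable.of_nonneg_of_le (fun n => by positivity) (fun n => ?_)
      (hs.mul_right (∑' n, ‖sinCoeff q n‖))
    rw [pow_two]
    exact mul_le_mul_of_nonneg_left (hs.le_tsum n fun _ _ => norm_nonneg _) (norm_nonneg _)
  have h3 : ∑' n : ℕ+, (n : ℂ) ^ 3 * q ^ (n : ℕ) / (1 - q ^ (n : ℕ)) =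
      ∑' n, (6 / 16 * sinCoeff q n ^ 2 + 1 / 4 * sinCoeff q n) := by
    rw [tsum_lambert_three hq, tsum_pnat_eq_tsum_succ (f := fun d : ℕ =>
      6 * (q ^ d / (1 - q ^ d) ^ 2) ^ 2 + q ^ d / (1 - q ^ d) ^ 2)]
    exact tsum_congr fun n => by rw [sinCoeff]; ring
  rw [h3, (hs2.mul_left _).tsum_add (hs.of_norm.mul_left _), tsum_mul_left, tsum_mul_left,
    tsum_sinCoeff hq]
  ring

end Lambert

/-! ### The product formula and the expansion of `θ₁` at the origin -/

section

/-- `∏_{n ≥ 1} (1 - qⁿ w)`. -/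
noncomputable def eulerProd (q w : ℂ) : ℂ := ∏' n : ℕ, (1 - q ^ (n + 1) * w)

/-- `∏_{n ≥ 1} (1 + aₙ s)` with `aₙ = 4 qⁿ / (1 - qⁿ)²`. -/
noncomputable def sinProd (q s : ℂ) : ℂ := ∏' n : ℕ, (1 + sinCoeff q n * s)

section

variable {q : ℂ}

theorem summable_norm_pow_succ_mul (hq : ‖q‖ < 1) (w : ℂ) :
    Summable fun n : ℕ => ‖-(q ^ (n + 1) * w)‖ := by
  simp only [norm_neg, norm_mul, norm_pow]
  exact ((summable_nat_add_iff 1).2 (summable_geometric_of_lt_one (norm_nonneg _) hq)).mul_right _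

theorem multipliable_eulerProd (hq : ‖q‖ < 1) (w : ℂ) :
    Multipliable fun n : ℕ => 1 - q ^ (n + 1) * w := by
  simpa only [sub_eq_add_neg] using
    multipliable_one_add_of_summable (f := fun n : ℕ => -(q ^ (n + 1) * w))
      (summable_norm_pow_succ_mul hq w)

theorem eulerProd_step (hq : ‖q‖ < 1) (w : ℂ) :
    eulerProd q w = (1 - q * w) * eulerProd q (q * w) := by
  have h := multipliable_eulerProd hq (q * w)
  have e : (fun n : ℕ => 1 - q ^ (n + 1) * (q * w)) = fun n : ℕ => 1 - q ^ (n + 1 + 1) * w := by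
    funext n; ring
  rw [e] at h
  rw [eulerProd, eulerProd, e, tprod_eq_zero_mul' (f := fun n : ℕ => 1 - q ^ (n + 1) * w) h,
    zero_add, pow_one]

theorem exists_of_eulerProd_eq_zero (hq : ‖q‖ < 1) {w : ℂ} (h : eulerProd q w = 0) :
    ∃ n : ℕ, q ^ (n + 1) * w = 1 := by
  by_contra! hne
  refine tprod_one_add_ne_zero_of_summable (f := fun n : ℕ => -(q ^ (n + 1) * w)) (fun n h0 => ?_)
    (summable_norm_pow_succ_mul hq w) (by simpa only [← sub_eq_add_neg, eulerProd] using h)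
  exact hne n (by linear_combination -h0)

theorem eulerProd_one_ne_zero (hq : ‖q‖ < 1) : eulerProd q 1 ≠ 0 := fun h => by
  obtain ⟨n, hn⟩ := exists_of_eulerProd_eq_zero hq h
  exact one_sub_pow_succ_ne_zero hq n (by linear_combination -hn)

theorem differentiable_sinProd (hq : ‖q‖ < 1) : Differentiable ℂ (sinProd q) :=
  differentiable_tprod_one_add_mul (summable_norm_sinCoeff hq)

theorem sinProd_zero : sinProd q 0 = 1 := by simp [sinProd]

/-- Pairing the factors of index `n`:
`(1 - qⁿ e^{2iz})(1 - qⁿ e^{-2iz}) = (1 - qⁿ)² + 4 qⁿ sin² z`. -/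
theorem eulerProd_mul_eulerProd (hq : ‖q‖ < 1) (z : ℂ) :
    eulerProd q (exp (2 * I * z)) * eulerProd q (exp (-(2 * I * z))) =
      eulerProd q 1 ^ 2 * sinProd q (sin z ^ 2) := by
  have hm : Multipliable fun n => 1 + sinCoeff q n * sin z ^ 2 :=
    multipliable_one_add_of_summable
      (by simpa only [norm_mul] using (summable_norm_sinCoeff hq).mul_right (‖sin z ^ 2‖))
  have h1 := multipliable_eulerProd hq 1
  rw [sinProd, pow_two, eulerProd, eulerProd, eulerProd,
    ← (multipliable_eulerProd hq _).tprod_mul (multipliable_eulerProd hq _),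
    ← h1.tprod_mul h1, ← (h1.mul h1).tprod_mul hm]
  refine tprod_congr fun n => ?_
  have hn := one_sub_pow_succ_ne_zero hq n
  have hs : exp (2 * I * z) + exp (-(2 * I * z)) = 2 - 4 * sin z ^ 2 := by
    have h2 := cos_sq' z
    have h3 := two_cos (x := 2 * z)
    rw [cos_two_mul, h2] at h3
    rw [show 2 * I * z = 2 * z * I by ring, show -(2 * z * I) = -(2 * z) * I by ring, ← h3]
    ring
  have hp : exp (2 * I * z) * exp (-(2 * I * z)) = 1 := by rw [← exp_add]; simp
  have h4 : (1 - q ^ (n + 1)) ^ 2 * sinCoeff q n = 4 * q ^ (n + 1) := by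
    rw [sinCoeff]; field_simp
  linear_combination (q ^ (n + 1)) ^ 2 * hp - q ^ (n + 1) * hs - sin z ^ 2 * h4

end

/-- The infinite product proportional to `θ₁`. -/
noncomputable def thetaProd (q z : ℂ) : ℂ :=
  sin z * (eulerProd q (exp (2 * I * z)) * eulerProd q (exp (-(2 * I * z))))

theorem thetaProd_eq {q : ℂ} (hq : ‖q‖ < 1) (z : ℂ) :
    thetaProd q z = eulerProd q 1 ^ 2 * (sin z * sinProd q (sin z ^ 2)) := by
  rw [thetaProd, eulerProd_mul_eulerProd hq]; ring

theorem differentiable_thetaProd {q : ℂ} (hq : ‖q‖ < 1) : Differentiable ℂ (thetaProd q) := by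
  have h : Differentiable ℂ fun z => sinProd q (sin z ^ 2) :=
    (differentiable_sinProd hq).comp (by fun_prop)
  rw [funext (thetaProd_eq hq)]
  fun_prop

theorem thetaProd_zero (q : ℂ) : thetaProd q 0 = 0 := by simp [thetaProd]

theorem deriv_thetaProd_zero {q : ℂ} (hq : ‖q‖ < 1) :
    deriv (thetaProd q) 0 = eulerProd q 1 ^ 2 := by
  have h : DifferentiableAt ℂ (fun z => sinProd q (sin z ^ 2)) 0 :=
    ((differentiable_sinProd hq).comp (by fun_prop : Differentiable ℂ fun z => sin z ^ 2)) 0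
  have h1 := (((hasDerivAt_sin 0).fun_mul h.hasDerivAt).const_mul (eulerProd q 1 ^ 2)).deriv
  rw [funext (thetaProd_eq hq), h1]
  simp [sinProd_zero]

theorem thetaProd_add_pi (q z : ℂ) : thetaProd q (z + Real.pi) = -thetaProd q z := by
  have h1 : exp (2 * I * (z + Real.pi)) = exp (2 * I * z) := by
    rw [show 2 * I * (z + Real.pi) = 2 * I * z + 2 * Real.pi * I by ring, exp_periodic]
  have h2 : exp (-(2 * I * (z + Real.pi))) = exp (-(2 * I * z)) := by
    rw [exp_neg, h1, exp_neg]
  rw [thetaProd, h1, h2, sin_add_pi, thetaProd]; ring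

variable {τ : ℂ}

theorem norm_nome_lt_one (hτ : 0 < τ.im) : ‖exp (2 * Real.pi * I * τ)‖ < 1 := by
  rw [norm_exp, Real.exp_lt_one_iff]
  have : (2 * Real.pi * I * τ).re = -(2 * Real.pi * τ.im) := by simp
  rw [this]
  have := Real.pi_pos
  have : 0 < 2 * Real.pi * τ.im := by positivity
  linarith

/-- Both `sin` and the two products are moved by one step, and the factor lost by one of the
products is the one that turns `sin (z + πτ)` into `sin z`. -/
theorem thetaProd_add_pi_mul (hτ : 0 < τ.im) (z : ℂ) :
    thetaProd (exp (2 * Real.pi * I * τ)) (z + Real.pi * τ) =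
      -exp (-(Real.pi * I * τ) - 2 * I * z) * thetaProd (exp (2 * Real.pi * I * τ)) z := by
  have hq := norm_nome_lt_one hτ
  set q := exp (2 * Real.pi * I * τ) with hqdef
  have e1 : exp (2 * I * (z + Real.pi * τ)) = q * exp (2 * I * z) := by
    rw [hqdef, ← exp_add]; ring_nf
  have e2 : q * exp (-(2 * I * (z + Real.pi * τ))) = exp (-(2 * I * z)) := by
    rw [hqdef, ← exp_add]; ring_nf
  have s1 := eulerProd_step hq (exp (2 * I * z))
  have s2 := eulerProd_step hq (exp (-(2 * I * (z + Real.pi * τ))))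
  rw [e2] at s2
  rw [thetaProd, thetaProd, e1, s1, s2]
  have key : sin (z + Real.pi * τ) * (1 - exp (-(2 * I * z))) =
      -exp (-(Real.pi * I * τ) - 2 * I * z) * sin z * (1 - q * exp (2 * I * z)) := by
    rw [sin, sin, hqdef,
      show -(z + Real.pi * τ) * I = -(z * I) + -(Real.pi * τ * I) by ring,
      show (z + Real.pi * τ) * I = z * I + Real.pi * τ * I by ring,
      show -(2 * I * z) = -(z * I) + -(z * I) by ring,
      show -(Real.pi * I * τ) - 2 * I * z = -(Real.pi * τ * I) + (-(z * I) + -(z * I)) by ring,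
      show 2 * I * z = z * I + z * I by ring,
      show 2 * Real.pi * I * τ = Real.pi * τ * I + Real.pi * τ * I by ring, neg_mul z]
    simp only [exp_add, exp_neg]
    have h1 := exp_ne_zero (z * I)
    have h2 := exp_ne_zero (Real.pi * τ * I)
    generalize exp (z * I) = a at *
    generalize exp (Real.pi * τ * I) = t at *
    field_simp
    ring
  linear_combination (eulerProd q (q * exp (2 * I * z)) * eulerProd q (exp (-(2 * I * z)))) * key

theorem exists_of_thetaProd_eq_zero (hτ : 0 < τ.im) {z : ℂ}
    (h : thetaProd (exp (2 * Real.pi * I * τ)) z = 0) :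
    ∃ m n : ℤ, z = m * Real.pi + n * (Real.pi * τ) := by
  have hq := norm_nome_lt_one hτ
  have aux : ∀ (n : ℕ) (w : ℂ), exp (2 * Real.pi * I * τ) ^ (n + 1) * exp (2 * I * w) = 1 →
      ∃ k : ℤ, w = k * Real.pi - (n + 1) * (Real.pi * τ) := by
    intro n w hw
    rw [← exp_nat_mul, ← exp_add, exp_eq_one_iff] at hw
    obtain ⟨k, hk⟩ := hw
    refine ⟨k, ?_⟩
    push_cast at hk
    have h2 : (2 * I) ≠ 0 := by simp
    refine mul_left_cancel₀ h2 ?_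
    linear_combination hk
  rcases mul_eq_zero.1 h with h | h
  · obtain ⟨k, hk⟩ := sin_eq_zero_iff.1 h
    exact ⟨k, 0, by simpa using hk⟩
  rcases mul_eq_zero.1 h with h | h
  · obtain ⟨n, hn⟩ := exists_of_eulerProd_eq_zero hq h
    obtain ⟨k, hk⟩ := aux n z hn
    exact ⟨k, -(n + 1), by rw [hk]; push_cast; ring⟩
  · obtain ⟨n, hn⟩ := exists_of_eulerProd_eq_zero hq h
    rw [← mul_neg] at hn
    obtain ⟨k, hk⟩ := aux n (-z) hn
    exact ⟨-k, n + 1, by push_cast; linear_combination -hk⟩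

theorem eventually_ne_zero_of_differentiable {f : ℂ → ℂ} (hf : Differentiable ℂ f) {w : ℂ}
    (hw : f w ≠ 0) (p : ℂ) : ∀ᶠ z in 𝓝[≠] p, f z ≠ 0 := by
  have ha : AnalyticOnNhd ℂ f Set.univ := fun z _ => hf.analyticAt z
  rcases (hf.analyticAt p).eventually_eq_zero_or_eventually_ne_zero with h | h
  · exact absurd (ha.eqOn_zero_of_preconnected_of_eventuallyEq_zero isPreconnected_univ
      (Set.mem_univ p) h (Set.mem_univ w)) hw
  · exact h

theorem RemovableAt.of_lattice {f : ℂ → ℂ} {ω₁ ω₂ c₁ c₂ p : ℂ} (h1 : QuasiPeriodic f ω₁ c₁)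
    (h2 : QuasiPeriodic f ω₂ c₂) (m n : ℤ) (h : RemovableAt f p) :
    RemovableAt f (p + m * ω₁ + n * ω₂) := by
  refine .of_translate (h1.int_mul (-m)) (.of_translate (h2.int_mul (-n)) ?_)
  convert h using 1
  push_cast
  ring

/-- **Product formula for `θ₁`**, without the value of the constant: the quotient of the two sides
is an elliptic function without poles. -/
theorem exists_theta1_eq_mul_thetaProd (hτ : 0 < τ.im) :
    ∃ C : ℂ, C ≠ 0 ∧ ∀ z, theta1 z τ = C * thetaProd (exp (2 * Real.pi * I * τ)) z := by
  have hq := norm_nome_lt_one hτ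
  set P := thetaProd (exp (2 * Real.pi * I * τ)) with hP
  have hPd : Differentiable ℂ P := differentiable_thetaProd hq
  have hθ := differentiable_theta1 hτ
  have hP' : deriv P 0 ≠ 0 := by
    rw [deriv_thetaProd_zero hq]
    exact pow_ne_zero _ (eulerProd_one_ne_zero hq)
  obtain ⟨w, hw⟩ : ∃ w, P w ≠ 0 := by
    by_contra! h
    exact hP' (by rw [show P = fun _ => 0 from funext h]; simp)
  have p1 : QuasiPeriodic (fun z => theta1 z τ / P z) Real.pi 0 := .of_forall fun z => by
    rw [theta1_add_pi, hP, thetaProd_add_pi, neg_div_neg_eq]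
  have p2 : QuasiPeriodic (fun z => theta1 z τ / P z) (Real.pi * τ) 0 := .of_forall fun z => by
    rw [theta1_add_pi_mul, hP, thetaProd_add_pi_mul hτ,
      mul_div_mul_left _ _ (neg_ne_zero.2 (exp_ne_zero _))]
  have hrem : ∀ p, RemovableAt (fun z => theta1 z τ / P z) p := by
    intro p
    by_cases hp : P p = 0
    · obtain ⟨m, n, rfl⟩ := exists_of_thetaProd_eq_zero hτ hp
      have h0 : RemovableAt (fun z => theta1 z τ / P z) 0 :=
        removableAt_div (hθ.analyticAt 0) (hPd.analyticAt 0) (theta1_zero τ)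
          (thetaProd_zero _) hP'
      simpa using RemovableAt.of_lattice p1 p2 m n h0
    · exact .of_analyticAt ((hθ.analyticAt p).div (hPd.analyticAt p) hp)
  have him : 0 < (Real.pi * τ : ℂ).im := by
    simpa using mul_pos Real.pi_pos hτ
  obtain ⟨-, C, hC⟩ := quasiPeriodic_const him hrem p1 p2
  have hCP : ∀ z, theta1 z τ = C * P z := by
    intro p
    refine eq_of_eventuallyEq_nhdsNE (f := fun z => theta1 z τ) (g := fun z => C * P z)
      (hθ.continuous.continuousAt) (hPd.continuous.const_mul C).continuousAt ?_
    filter_upwards [hC p, eventually_ne_zero_of_differentiable hPd hw p] with z h1 h2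
    rw [← h1, div_mul_cancel₀ _ h2]
  refine ⟨C, ?_, hCP⟩
  rintro rfl
  obtain ⟨z, hz⟩ := exists_theta1_ne_zero hτ
  exact hz (by rw [hCP, zero_mul])

theorem exists_of_theta1_eq_zero (hτ : 0 < τ.im) {z : ℂ} (h : theta1 z τ = 0) :
    ∃ m n : ℤ, z = m * Real.pi + n * (Real.pi * τ) := by
  obtain ⟨C, hC, hθ⟩ := exists_theta1_eq_mul_thetaProd hτ
  rw [hθ] at h
  exact exists_of_thetaProd_eq_zero hτ ((mul_eq_zero.1 h).resolve_left hC)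

theorem vartheta1'_ne_zero (hτ : 0 < τ.im) : vartheta1' τ ≠ 0 := by
  have hq := norm_nome_lt_one hτ
  obtain ⟨C, hC, hθ⟩ := exists_theta1_eq_mul_thetaProd hτ
  rw [vartheta1', funext hθ, deriv_const_mul _ (differentiable_thetaProd hq 0),
    deriv_thetaProd_zero hq]
  exact mul_ne_zero hC (pow_ne_zero _ (eulerProd_one_ne_zero hq))

theorem qPow_pnat (τ : ℂ) (n : ℕ+) : qPow τ n = exp (2 * Real.pi * I * τ) ^ (n : ℕ) := by
  rw [qPow, ← exp_nat_mul]
  ring_nf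

theorem L_eq (hτ : 0 < τ.im) :
    L τ = 1 - 6 * ∑' n, sinCoeff (exp (2 * Real.pi * I * τ)) n := by
  rw [tsum_sinCoeff (norm_nome_lt_one hτ), L]
  simp only [qPow_pnat]
  ring

theorem M_eq (hτ : 0 < τ.im) :
    M τ = 1 + 90 * ∑' n, sinCoeff (exp (2 * Real.pi * I * τ)) n ^ 2 +
      60 * ∑' n, sinCoeff (exp (2 * Real.pi * I * τ)) n := by
  rw [tsum_sinCoeff (norm_nome_lt_one hτ), tsum_sinCoeff_sq (norm_nome_lt_one hτ), M]
  simp only [qPow_pnat]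
  ring

/-- The expansion `θ₁(z) / ϑ₁' = z - L z³ / 6 + (L² / 72 - M / 180) z⁵ + ⋯`. -/
theorem exists_theta1_eq_mul_hasJet (hτ : 0 < τ.im) :
    ∃ u : ℂ → ℂ, HasJet u 1 (-L τ / 6) (L τ ^ 2 / 72 - M τ / 180) ∧
      ∀ z, theta1 z τ = vartheta1' τ * (z * u z) := by
  have hq := norm_nome_lt_one hτ
  obtain ⟨C, -, hθ⟩ := exists_theta1_eq_mul_thetaProd hτ
  obtain ⟨s, hs, hsin⟩ := exists_sin_eq_mul_hasJet
  have hF := hasJet_comp_sin_sq ((differentiable_sinProd hq).analyticAt 0)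
  obtain ⟨d1, d2⟩ := deriv_tprod_one_add_mul (summable_norm_sinCoeff hq)
  change deriv (sinProd _) 0 = _ at d1
  change iteratedDeriv 2 (sinProd _) 0 = _ at d2
  rw [d1, d2, sinProd_zero] at hF
  refine ⟨fun z => s z * sinProd (exp (2 * Real.pi * I * τ)) (sin z ^ 2), ?_, fun z => ?_⟩
  · convert hs.mul hF using 1
    · ring
    · rw [L_eq hτ]; ring
    · rw [L_eq hτ, M_eq hτ]; ring
  · rw [vartheta1', funext hθ, deriv_const_mul _ (differentiable_thetaProd hq 0),
      deriv_thetaProd_zero hq]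
    simp only [← mul_assoc z, ← hsin]
    rw [hθ, thetaProd_eq hq]
    ring

end

/-! ### The residue theorem for the theta quotient -/

section LogDerivative

variable {τ : ℂ}

theorem deriv_theta1_add_pi (τ z : ℂ) :
    deriv (fun z => theta1 z τ) (z + Real.pi) = -deriv (fun z => theta1 z τ) z := by
  rw [← deriv_comp_add_const (fun z => theta1 z τ)]
  simp only [theta1_add_pi, deriv.fun_neg]

theorem deriv_theta1_add_pi_mul (hτ : 0 < τ.im) (z : ℂ) :
    deriv (fun z => theta1 z τ) (z + Real.pi * τ) =
      -exp (-(Real.pi * I * τ) - 2 * I * z) *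
        (deriv (fun z => theta1 z τ) z - 2 * I * theta1 z τ) := by
  rw [← deriv_comp_add_const (fun z => theta1 z τ)]
  simp only [theta1_add_pi_mul]
  have h1 : HasDerivAt (fun z => -(Real.pi * I * τ) - 2 * I * z) (-(2 * I * 1)) z :=
    ((hasDerivAt_id z).const_mul (2 * I)).const_sub _
  rw [(h1.cexp.fun_neg.fun_mul (differentiable_theta1 hτ z).hasDerivAt).deriv]
  ring

/-- The logarithmic derivative `θ₁' / θ₁`; it takes the junk value `0` on the period lattice. -/
noncomputable def thetaZeta (τ z : ℂ) : ℂ := deriv (fun z => theta1 z τ) z / theta1 z τ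

theorem quasiPeriodic_thetaZeta_pi (τ : ℂ) : QuasiPeriodic (thetaZeta τ) Real.pi 0 :=
  .of_forall fun z => by
    rw [thetaZeta, deriv_theta1_add_pi, theta1_add_pi, neg_div_neg_eq, thetaZeta]

theorem quasiPeriodic_thetaZeta_pi_mul (hτ : 0 < τ.im) :
    QuasiPeriodic (thetaZeta τ) (Real.pi * τ) (-(2 * I)) := fun p => by
  obtain ⟨w, hw⟩ := exists_theta1_ne_zero hτ
  filter_upwards [eventually_ne_zero_of_differentiable (differentiable_theta1 hτ) hw p] with z hz
  rw [thetaZeta, deriv_theta1_add_pi_mul hτ, theta1_add_pi_mul,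
    mul_div_mul_left _ _ (neg_ne_zero.2 (exp_ne_zero _)), thetaZeta]
  field_simp
  ring

theorem analyticAt_thetaZeta (hτ : 0 < τ.im) {p : ℂ} (hp : theta1 p τ ≠ 0) :
    AnalyticAt ℂ (thetaZeta τ) p :=
  ((differentiable_theta1 hτ).analyticAt p).deriv.div ((differentiable_theta1 hτ).analyticAt p) hp

theorem removableAt_thetaZeta_sub_inv (hτ : 0 < τ.im) :
    RemovableAt (fun z => thetaZeta τ z - 1 * z ^ (-1 : ℤ)) 0 := by
  have ha := (differentiable_theta1 hτ).analyticAt 0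
  have h := removableAt_div_sub_pole ha.deriv ha (theta1_zero τ) (vartheta1'_ne_zero hτ)
  rw [div_self (show deriv (fun z => theta1 z τ) 0 ≠ 0 from vartheta1'_ne_zero hτ)] at h
  simpa [thetaZeta] using h

theorem removableAt_thetaZeta_translate_sub_inv (hτ : 0 < τ.im) (p : ℂ) :
    RemovableAt (fun z => thetaZeta τ (z - p) - (z - p)⁻¹) p := by
  obtain ⟨a, ha, h⟩ := removableAt_thetaZeta_sub_inv hτ
  rw [show (0 : ℂ) = p + -p by ring] at h ha
  refine ⟨fun z => a (z + -p), ?_, ?_⟩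
  · exact AnalyticAt.comp (g := a) (f := fun z : ℂ => z + -p) ha (by fun_prop)
  · filter_upwards [(tendsto_add_const_nhdsNE p (-p)).eventually h] with z hz
    rw [← hz]
    simp [sub_eq_add_neg]

/-- The only points of the period lattice among the half periods are those with even
coordinates. -/
theorem theta1_halfPeriod_ne_zero (hτ : 0 < τ.im) {a b : ℤ} (h : ¬(2 ∣ a ∧ 2 ∣ b)) :
    theta1 (a * (Real.pi / 2) + b * (Real.pi * τ / 2)) τ ≠ 0 := by
  intro h0
  obtain ⟨m, n, hmn⟩ := exists_of_theta1_eq_zero hτ h0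
  have hpi := Real.pi_pos.ne'
  have hpi' : (Real.pi : ℂ) ≠ 0 := by exact_mod_cast hpi
  have e : ((a - 2 * m : ℤ) : ℂ) + ((b - 2 * n : ℤ) : ℂ) * τ = 0 := by
    refine (mul_eq_zero.1 (?_ : (Real.pi : ℂ) / 2 * _ = 0)).resolve_left (by simp [hpi])
    push_cast
    linear_combination hmn
  have hb : b - 2 * n = 0 := by
    have h1 := congrArg Complex.im e
    simpa [hτ.ne', -Int.cast_sub] using h1
  have ha : a - 2 * m = 0 := by
    rw [hb] at e
    simpa [-Int.cast_sub] using e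
  exact h ⟨⟨m, by linarith⟩, ⟨n, by linarith⟩⟩

end LogDerivative

section Quotient

variable {τ : ℂ}

theorem nine_mul_im_pos (hτ : 0 < τ.im) : 0 < (9 * τ).im := by simpa using hτ

theorem theta1_add_nine_pi_mul (z τ : ℂ) :
    theta1 (z + Real.pi * (9 * τ)) τ =
      -exp (-(81 * (Real.pi * I * τ)) - 18 * I * z) * theta1 z τ := by
  rw [show z + Real.pi * (9 * τ) = z + 4 * (Real.pi * τ) + 4 * (Real.pi * τ) + Real.pi * τ by ring]
  rw [theta1_add_pi_mul, theta1_add_four_pi_mul, theta1_add_four_pi_mul, neg_mul, neg_mul,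
    ← mul_assoc, ← mul_assoc, ← exp_add, ← exp_add]
  ring_nf

/-- The elliptic function `θ₁(z|τ) / (θ₁(z|9τ)⁵ θ₁(2z|9τ))` with periods `π` and `9πτ`. -/
noncomputable def thetaQuot (τ z : ℂ) : ℂ :=
  theta1 z τ / (theta1 z (9 * τ) ^ 5 * theta1 (2 * z) (9 * τ))

theorem quasiPeriodic_thetaQuot_pi (τ : ℂ) : QuasiPeriodic (thetaQuot τ) Real.pi 0 :=
  .of_forall fun z => by
    rw [thetaQuot, theta1_add_pi, theta1_add_pi,
      show 2 * (z + Real.pi) = 2 * z + Real.pi + Real.pi by ring, theta1_add_pi, theta1_add_pi,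
      neg_neg, Odd.neg_pow (by decide), neg_mul, neg_div_neg_eq, thetaQuot]

theorem quasiPeriodic_thetaQuot_pi_mul (τ : ℂ) :
    QuasiPeriodic (thetaQuot τ) (Real.pi * (9 * τ)) 0 :=
  .of_forall fun z => by
    rw [thetaQuot, theta1_add_nine_pi_mul, theta1_add_pi_mul,
      show 2 * (z + Real.pi * (9 * τ)) = 2 * z + Real.pi * (9 * τ) + Real.pi * (9 * τ) by ring,
      theta1_add_pi_mul, theta1_add_pi_mul, mul_pow, Odd.neg_pow (by decide), ← exp_nat_mul]
    rw [show (-exp ((5 : ℕ) * (-(Real.pi * I * (9 * τ)) - 2 * I * z)) * theta1 z (9 * τ) ^ 5 *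
        (-exp (-(Real.pi * I * (9 * τ)) - 2 * I * (2 * z + Real.pi * (9 * τ))) *
          (-exp (-(Real.pi * I * (9 * τ)) - 2 * I * (2 * z)) * theta1 (2 * z) (9 * τ)))) =
        -(exp ((5 : ℕ) * (-(Real.pi * I * (9 * τ)) - 2 * I * z)) *
          exp (-(Real.pi * I * (9 * τ)) - 2 * I * (2 * z + Real.pi * (9 * τ))) *
          exp (-(Real.pi * I * (9 * τ)) - 2 * I * (2 * z))) *
          (theta1 z (9 * τ) ^ 5 * theta1 (2 * z) (9 * τ)) by ring, ← exp_add, ← exp_add]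
    rw [show (5 : ℕ) * (-(Real.pi * I * (9 * τ)) - 2 * I * z) +
        (-(Real.pi * I * (9 * τ)) - 2 * I * (2 * z + Real.pi * (9 * τ))) +
        (-(Real.pi * I * (9 * τ)) - 2 * I * (2 * z)) = -(81 * (Real.pi * I * τ)) - 18 * I * z by
          push_cast; ring,
      mul_div_mul_left _ _ (neg_ne_zero.2 (exp_ne_zero _)), thetaQuot]

theorem analyticAt_thetaQuot (hτ : 0 < τ.im) {p : ℂ} (hp : theta1 p (9 * τ) ≠ 0)
    (hp2 : theta1 (2 * p) (9 * τ) ≠ 0) : AnalyticAt ℂ (thetaQuot τ) p := by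
  have hθ := differentiable_theta1 (nine_mul_im_pos hτ)
  have h1 : Differentiable ℂ fun z => theta1 (2 * z) (9 * τ) := hθ.comp (by fun_prop)
  exact ((differentiable_theta1 hτ).analyticAt p).div
    (((hθ.analyticAt p).pow 5).mul (h1.analyticAt p)) (mul_ne_zero (pow_ne_zero 5 hp) hp2)

/-- At a half period the quotient has a simple pole, with the residue `ρ`. -/
theorem removableAt_thetaQuot_halfPeriod (hτ : 0 < τ.im) {p d ρ : ℂ}
    (hp : theta1 p (9 * τ) ≠ 0) (hp2 : theta1 (2 * p) (9 * τ) = 0)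
    (hd : deriv (fun z => theta1 z (9 * τ)) (2 * p) = d) (hd0 : d ≠ 0)
    (hρ : ρ = theta1 p τ / theta1 p (9 * τ) ^ 5 / (2 * d)) :
    RemovableAt (fun z => thetaQuot τ z - ρ * thetaZeta (9 * τ) (z - p)) p := by
  have hθ := differentiable_theta1 (nine_mul_im_pos hτ)
  have h1 : Differentiable ℂ fun z => theta1 (2 * z) (9 * τ) := hθ.comp (by fun_prop)
  have hd1 : deriv (fun z => theta1 (2 * z) (9 * τ)) p = 2 * d := by
    rw [deriv_comp_mul_left 2 (fun z => theta1 z (9 * τ)), hd, smul_eq_mul]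
  have hN : AnalyticAt ℂ (fun z => theta1 z τ / theta1 z (9 * τ) ^ 5) p :=
    ((differentiable_theta1 hτ).analyticAt p).div ((hθ.analyticAt p).pow 5) (pow_ne_zero 5 hp)
  have hpole := removableAt_div_sub_pole hN (h1.analyticAt p) hp2
    (by rw [hd1]; exact mul_ne_zero two_ne_zero hd0)
  rw [hd1, ← hρ] at hpole
  refine (hpole.sub ((removableAt_thetaZeta_translate_sub_inv (nine_mul_im_pos hτ) p).const_mul
    ρ)).congr (Eventually.of_forall fun z => ?_)
  simp only [thetaQuot, div_div]
  ring

/-- The polar part of the quotient at the origin. -/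
theorem removableAt_thetaQuot_zero (hτ : 0 < τ.im) {k₀ k₂ k₄ : ℂ}
    (h₀ : k₀ = vartheta1' τ / (2 * vartheta1' (9 * τ) ^ 6))
    (h₂ : k₂ = k₀ * ((9 * L (9 * τ) - L τ) / 6))
    (h₄ : k₄ = k₀ * ((9 * L (9 * τ) - L τ) ^ 2 / 72 + (21 * M (9 * τ) - M τ) / 180)) :
    RemovableAt (fun z => thetaQuot τ z -
      (k₀ * z ^ (-5 : ℤ) + k₂ * z ^ (-3 : ℤ) + k₄ * z ^ (-1 : ℤ))) 0 := by
  obtain ⟨u, hu, hf⟩ := exists_theta1_eq_mul_hasJet hτ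
  obtain ⟨v, hv, hθ⟩ := exists_theta1_eq_mul_hasJet (nine_mul_im_pos hτ)
  have hne := vartheta1'_ne_zero (nine_mul_im_pos hτ)
  have hv2 := hv.mul hv
  have hV := (((hv2.mul hv2).mul hv).mul (hv.scale 2)).const_mul (2 * vartheta1' (9 * τ) ^ 6)
  have hk : 2 * vartheta1' (9 * τ) ^ 6 * k₀ = vartheta1' τ := by
    rw [h₀]; field_simp
  refine ((hu.const_mul (vartheta1' τ)).removableAt_div_sub_poles (k₀ := k₀) (k₂ := k₂) (k₄ := k₄)
    hV ?_ ?_ ?_ ?_).congr ?_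
  · simp [hne]
  · linear_combination -hk
  · rw [h₂, ← hk]; ring
  · rw [h₄, h₂, ← hk]; ring
  · filter_upwards [self_mem_nhdsWithin] with z hz
    have hz : z ≠ 0 := hz
    rw [thetaQuot, hf, hθ, hθ]
    congr 1
    rw [show (vartheta1' (9 * τ) * (z * v z)) ^ 5 * (vartheta1' (9 * τ) * (2 * z * v (2 * z))) =
      z * (z ^ 5 * (2 * vartheta1' (9 * τ) ^ 6 * (v z * v z * (v z * v z) * v z * v (2 * z)))) by
        ring, show vartheta1' τ * (z * u z) = z * (vartheta1' τ * u z) by ring,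
      mul_div_mul_left _ _ hz]

/-- **The residue theorem for the quotient.** Subtracting `θ₁' / θ₁`, its translates and its
derivatives removes all poles; what is left is constant, and comparing its values at `z` and
`z + 9πτ` shows that the residues add up to zero. -/
theorem thetaQuot_residues (hτ : 0 < τ.im) {ρ₁ ρ₂ ρ₃ k₀ k₂ k₄ : ℂ}
    (hk : RemovableAt (fun z => thetaQuot τ z -
      (k₀ * z ^ (-5 : ℤ) + k₂ * z ^ (-3 : ℤ) + k₄ * z ^ (-1 : ℤ))) 0)
    (h₁ : RemovableAt (fun z => thetaQuot τ z -
      ρ₁ * thetaZeta (9 * τ) (z - (Real.pi / 2))) (Real.pi / 2))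
    (h₂ : RemovableAt (fun z => thetaQuot τ z -
      ρ₂ * thetaZeta (9 * τ) (z - (Real.pi * (9 * τ) / 2))) (Real.pi * (9 * τ) / 2))
    (h₃ : RemovableAt (fun z => thetaQuot τ z -
      ρ₃ * thetaZeta (9 * τ) (z - (Real.pi / 2 + Real.pi * (9 * τ) / 2)))
        (Real.pi / 2 + Real.pi * (9 * τ) / 2)) :
    k₄ + ρ₁ + ρ₂ + ρ₃ = 0 := by
  have hT := nine_mul_im_pos hτ
  set T := 9 * τ with hTdef
  set Z := thetaZeta T with hZ
  set π₁ : ℂ := Real.pi / 2 with hπ₁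
  set π₂ : ℂ := Real.pi * T / 2 with hπ₂
  -- `A` has the polar part of the quotient at `0`: that of `Z` is `z⁻¹`, that of its second
  -- derivative `2 z⁻³`, that of its fourth derivative `24 z⁻⁵`.
  set A : ℂ → ℂ := fun z => k₀ / 24 * deriv (deriv (deriv (deriv Z))) z + k₂ / 2 * deriv (deriv Z) z
    + k₄ * Z z with hA
  set h : ℂ → ℂ := fun z => thetaQuot τ z -
    (A z + ρ₁ * Z (z - π₁) + ρ₂ * Z (z - π₂) + ρ₃ * Z (z - (π₁ + π₂))) with hh
  have z1 := quasiPeriodic_thetaZeta_pi T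
  have z2 := quasiPeriodic_thetaZeta_pi_mul hT
  have per : ∀ ω c, QuasiPeriodic (thetaQuot τ) ω 0 → QuasiPeriodic Z ω c →
      QuasiPeriodic h ω (-(k₄ + ρ₁ + ρ₂ + ρ₃) * c) := by
    intro ω c hq hz
    have hA' := ((hz.deriv.deriv.deriv.deriv.const_mul (k₀ / 24)).add
      (hz.deriv.deriv.const_mul (k₂ / 2))).add (hz.const_mul k₄)
    have := hq.sub (((hA'.add ((hz.comp_sub_const π₁).const_mul ρ₁)).add
      ((hz.comp_sub_const π₂).const_mul ρ₂)).add ((hz.comp_sub_const (π₁ + π₂)).const_mul ρ₃))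
    convert this using 1
    ring
  have q1 : QuasiPeriodic h Real.pi 0 := by
    simpa using per _ _ (quasiPeriodic_thetaQuot_pi τ) z1
  have q2 := per _ _ (quasiPeriodic_thetaQuot_pi_mul τ) z2
  have anZ : ∀ {p}, theta1 p T ≠ 0 → AnalyticAt ℂ Z p := fun hp => analyticAt_thetaZeta hT hp
  have anA : ∀ {p}, theta1 p T ≠ 0 → AnalyticAt ℂ A p := fun hp => by
    have h1 := anZ hp
    have h2 := h1.deriv.deriv
    have h4 := h2.deriv.deriv
    exact ((analyticAt_const.mul h4).add (analyticAt_const.mul h2)).add (analyticAt_const.mul h1)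
  have anZs : ∀ {p w}, theta1 (p - w) T ≠ 0 → AnalyticAt ℂ (fun z => Z (z - w)) p := fun hp =>
    AnalyticAt.comp (g := Z) (f := fun z => z - _) (anZ hp) (by fun_prop)
  -- Differences of distinct half periods are not periods, so every other term is analytic there.
  have half : ∀ (a b : ℤ) (w : ℂ), w = a * π₁ + b * π₂ → ¬(2 ∣ a ∧ 2 ∣ b) → theta1 w T ≠ 0 :=
    fun a b w hw hab => hw ▸ theta1_halfPeriod_ne_zero hT hab
  have r0 : RemovableAt h 0 := by
    have i1 := removableAt_thetaZeta_sub_inv hT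
    have i3 := removableAt_deriv_sub_zpow (removableAt_deriv_sub_zpow i1)
    have i5 := removableAt_deriv_sub_zpow (removableAt_deriv_sub_zpow i3)
    have a1 := anZs (p := 0) (w := π₁) (half (-1) 0 _ (by push_cast; ring) (by decide))
    have a2 := anZs (p := 0) (w := π₂) (half 0 (-1) _ (by push_cast; ring) (by decide))
    have a3 := anZs (p := 0) (w := π₁ + π₂) (half (-1) (-1) _ (by push_cast; ring) (by decide))
    refine ((hk.sub (((i5.const_mul (k₀ / 24)).add (i3.const_mul (k₂ / 2))).add
      (i1.const_mul k₄))).sub (.of_analyticAt (((analyticAt_const (v := ρ₁)).mul a1).add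
      ((analyticAt_const (v := ρ₂)).mul a2) |>.add ((analyticAt_const (v := ρ₃)).mul a3)))).congr
      (Eventually.of_forall fun z => ?_)
    simp only [hh, hA, Pi.add_apply, Pi.mul_apply]
    norm_num
    ring
  have r1 : RemovableAt h π₁ := by
    have a0 := anA (p := π₁) (half 1 0 _ (by push_cast; ring) (by decide))
    have a2 := anZs (p := π₁) (w := π₂) (half 1 (-1) _ (by push_cast; ring) (by decide))
    have a3 := anZs (p := π₁) (w := π₁ + π₂) (half 0 (-1) _ (by push_cast; ring) (by decide))
    refine (h₁.sub (.of_analyticAt ((a0.add ((analyticAt_const (v := ρ₂)).mul a2)).add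
      ((analyticAt_const (v := ρ₃)).mul a3)))).congr (Eventually.of_forall fun z => ?_)
    simp only [hh, Pi.add_apply, Pi.mul_apply]
    ring
  have r2 : RemovableAt h π₂ := by
    have a0 := anA (p := π₂) (half 0 1 _ (by push_cast; ring) (by decide))
    have a1 := anZs (p := π₂) (w := π₁) (half (-1) 1 _ (by push_cast; ring) (by decide))
    have a3 := anZs (p := π₂) (w := π₁ + π₂) (half (-1) 0 _ (by push_cast; ring) (by decide))
    refine (h₂.sub (.of_analyticAt ((a0.add ((analyticAt_const (v := ρ₁)).mul a1)).add
      ((analyticAt_const (v := ρ₃)).mul a3)))).congr (Eventually.of_forall fun z => ?_)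
    simp only [hh, Pi.add_apply, Pi.mul_apply]
    ring
  have r3 : RemovableAt h (π₁ + π₂) := by
    have a0 := anA (p := π₁ + π₂) (half 1 1 _ (by push_cast; ring) (by decide))
    have a1 := anZs (p := π₁ + π₂) (w := π₁) (half 0 1 _ (by push_cast; ring) (by decide))
    have a2 := anZs (p := π₁ + π₂) (w := π₂) (half 1 0 _ (by push_cast; ring) (by decide))
    refine (h₃.sub (.of_analyticAt ((a0.add ((analyticAt_const (v := ρ₁)).mul a1)).add
      ((analyticAt_const (v := ρ₂)).mul a2)))).congr (Eventually.of_forall fun z => ?_)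
    simp only [hh, Pi.add_apply, Pi.mul_apply]
    ring
  have hrem : ∀ p, RemovableAt h p := by
    intro p
    by_cases hp : ∃ a b : ℤ, p = a * π₁ + b * π₂
    · obtain ⟨a, b, rfl⟩ := hp
      obtain ⟨m, rfl | rfl⟩ := Int.even_or_odd' a <;> obtain ⟨n, rfl | rfl⟩ := Int.even_or_odd' b
      · convert RemovableAt.of_lattice q1 q2 m n r0 using 1
        push_cast; ring
      · convert RemovableAt.of_lattice q1 q2 m n r2 using 1
        push_cast; ring
      · convert RemovableAt.of_lattice q1 q2 m n r1 using 1
        push_cast; ring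
      · convert RemovableAt.of_lattice q1 q2 m n r3 using 1
        push_cast; ring
    -- Away from the half periods all terms are analytic.
    · have hne : ∀ (a b : ℤ), theta1 (p - (a * π₁ + b * π₂)) T ≠ 0 := by
        intro a b h0
        obtain ⟨m, n, hmn⟩ := exists_of_theta1_eq_zero hT h0
        exact hp ⟨a + 2 * m, b + 2 * n, by push_cast; linear_combination hmn⟩
      have hne2 : theta1 (2 * p) T ≠ 0 := by
        intro h0
        obtain ⟨m, n, hmn⟩ := exists_of_theta1_eq_zero hT h0
        exact hp ⟨m, n, by linear_combination hmn / 2⟩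
      have hne0 : theta1 p T ≠ 0 := by simpa using hne 0 0
      exact .of_analyticAt ((analyticAt_thetaQuot hτ hne0 hne2).sub
        ((((anA hne0).add (analyticAt_const.mul (anZs (by simpa using hne 1 0)))).add
        (analyticAt_const.mul (anZs (by simpa using hne 0 1)))).add
        (analyticAt_const.mul (anZs (by simpa using hne 1 1)))))
  have him : 0 < (Real.pi * T).im := by
    rw [im_ofReal_mul]; exact mul_pos Real.pi_pos hT
  have hc := (quasiPeriodic_const him hrem q1 q2).1
  have hI : (2 * I) ≠ 0 := by simp
  have := (mul_eq_zero.1 hc).resolve_right (neg_ne_zero.2 hI)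
  linear_combination -this

/-- The vanishing of the sum of the residues, with their values inserted. -/
theorem thetaQuot_residues_eq (hτ : 0 < τ.im) :
    vartheta1' τ / (2 * vartheta1' (9 * τ) ^ 6) *
        ((9 * L (9 * τ) - L τ) ^ 2 / 72 + (21 * M (9 * τ) - M τ) / 180) =
      1 / (2 * vartheta1' (9 * τ)) * (vartheta2 τ / vartheta2 (9 * τ) ^ 5 -
        vartheta3 τ / vartheta3 (9 * τ) ^ 5 + vartheta4 τ / vartheta4 (9 * τ) ^ 5) := by
  have hT := nine_mul_im_pos hτ
  have hd := vartheta1'_ne_zero hT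
  -- With `x = q ^ (-1/8)`, all the exponential factors below are powers of `x`; they cancel in the
  -- residues because `81 = 5 * 9 + 36`.
  set x := exp (-(Real.pi * I * τ) / 4) with hx
  have hx0 : x ≠ 0 := exp_ne_zero _
  have hx9 : exp (-(Real.pi * I * (9 * τ)) / 4) = x ^ 9 := by
    rw [hx, ← exp_nat_mul]; push_cast; ring_nf
  -- values at the half periods
  have t1 := theta1_pi_div_two hT
  have t2 := theta1_pi_mul_div_two hT
  have t3 := theta1_pi_add_pi_mul_div_two hT
  rw [hx9] at t2 t3
  have n1 := theta1_halfPeriod_ne_zero hT (a := 1) (b := 0) (by decide)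
  have n2 := theta1_halfPeriod_ne_zero hT (a := 0) (b := 1) (by decide)
  have n3 := theta1_halfPeriod_ne_zero hT (a := 1) (b := 1) (by decide)
  simp only [Int.cast_one, Int.cast_zero, one_mul, zero_mul, add_zero, zero_add] at n1 n2 n3
  have f2 : theta1 (Real.pi * (9 * τ) / 2) τ = I * x ^ 81 * vartheta4 τ := by
    rw [show Real.pi * (9 * τ) / 2 = Real.pi * τ / 2 + 4 * (Real.pi * τ) by ring,
      theta1_add_four_pi_mul, theta1_pi_mul_div_two hτ,
      show exp (-(16 * (Real.pi * I * τ)) - 8 * I * (Real.pi * τ / 2)) = x ^ 80 by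
        rw [hx, ← exp_nat_mul]; push_cast; ring_nf]
    ring
  have f3 : theta1 (Real.pi / 2 + Real.pi * (9 * τ) / 2) τ = x ^ 81 * vartheta3 τ := by
    rw [show Real.pi / 2 + Real.pi * (9 * τ) / 2 =
        Real.pi / 2 + Real.pi * τ / 2 + 4 * (Real.pi * τ) by ring,
      theta1_add_four_pi_mul, theta1_pi_add_pi_mul_div_two hτ,
      show exp (-(16 * (Real.pi * I * τ)) - 8 * I * (Real.pi / 2 + Real.pi * τ / 2)) = x ^ 80 by
        rw [hx, ← exp_nat_mul, exp_eq_exp_iff_exists_int]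
        exact ⟨-2, by push_cast; ring⟩]
    ring
  -- values and derivatives at the periods
  have w1 : theta1 Real.pi (9 * τ) = 0 := by
    simpa [theta1_zero] using theta1_add_pi 0 (9 * τ)
  have w2 : theta1 (Real.pi * (9 * τ)) (9 * τ) = 0 := by
    simpa [theta1_zero] using theta1_add_pi_mul 0 (9 * τ)
  have w3 : theta1 (Real.pi * (9 * τ) + Real.pi) (9 * τ) = 0 := by
    rw [theta1_add_pi, w2, neg_zero]
  have d1 : deriv (fun z => theta1 z (9 * τ)) Real.pi = -vartheta1' (9 * τ) := by
    simpa [vartheta1'] using deriv_theta1_add_pi (9 * τ) 0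
  have hx36 : exp (-(Real.pi * I * (9 * τ))) = x ^ 36 := by
    rw [hx, ← exp_nat_mul]; push_cast; ring_nf
  have d2 : deriv (fun z => theta1 z (9 * τ)) (Real.pi * (9 * τ)) =
      -(x ^ 36 * vartheta1' (9 * τ)) := by
    have h := deriv_theta1_add_pi_mul hT 0
    rw [zero_add, theta1_zero, mul_zero, sub_zero, sub_zero, hx36, neg_mul] at h
    exact h
  have d3 : deriv (fun z => theta1 z (9 * τ)) (Real.pi * (9 * τ) + Real.pi) =
      x ^ 36 * vartheta1' (9 * τ) := by
    rw [deriv_theta1_add_pi, d2, neg_neg]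
  have e1 : 2 * ((Real.pi : ℂ) / 2) = Real.pi := by ring
  have e2 : 2 * ((Real.pi : ℂ) * (9 * τ) / 2) = Real.pi * (9 * τ) := by ring
  have e3 : 2 * ((Real.pi : ℂ) / 2 + Real.pi * (9 * τ) / 2) = Real.pi * (9 * τ) + Real.pi := by ring
  have hx36d : x ^ 36 * vartheta1' (9 * τ) ≠ 0 := mul_ne_zero (pow_ne_zero _ hx0) hd
  have key := thetaQuot_residues hτ (removableAt_thetaQuot_zero hτ rfl rfl rfl)
    (removableAt_thetaQuot_halfPeriod hτ n1 (by rw [e1, w1]) (by rw [e1, d1])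
      (neg_ne_zero.2 hd) rfl)
    (removableAt_thetaQuot_halfPeriod hτ n2 (by rw [e2, w2]) (by rw [e2, d2])
      (neg_ne_zero.2 hx36d) rfl)
    (removableAt_thetaQuot_halfPeriod hτ n3 (by rw [e3, w3]) (by rw [e3, d3]) hx36d rfl)
  rw [f2, f3, theta1_pi_div_two hτ, t1, t2, t3] at key
  rw [t1] at n1
  rw [t2] at n2
  rw [t3] at n3
  have v4 := right_ne_zero_of_mul n2
  have v3 := right_ne_zero_of_mul n3
  have r1 : vartheta2 τ / vartheta2 (9 * τ) ^ 5 / (2 * -vartheta1' (9 * τ)) =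
      -(1 / (2 * vartheta1' (9 * τ)) * (vartheta2 τ / vartheta2 (9 * τ) ^ 5)) := by
    field_simp
  have r2 : I * x ^ 81 * vartheta4 τ / (I * x ^ 9 * vartheta4 (9 * τ)) ^ 5 /
      (2 * -(x ^ 36 * vartheta1' (9 * τ))) =
      -(1 / (2 * vartheta1' (9 * τ)) * (vartheta4 τ / vartheta4 (9 * τ) ^ 5)) := by
    have hI := I_ne_zero
    have hI5 : I ^ 5 = I := by rw [pow_succ, I_pow_four, one_mul]
    rw [mul_pow, mul_pow, hI5]
    field_simp
  have r3 : x ^ 81 * vartheta3 τ / (x ^ 9 * vartheta3 (9 * τ)) ^ 5 /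
      (2 * (x ^ 36 * vartheta1' (9 * τ))) =
      1 / (2 * vartheta1' (9 * τ)) * (vartheta3 τ / vartheta3 (9 * τ) ^ 5) := by
    field_simp
  rw [r1, r2, r3] at key
  linear_combination key

end Quotient

end ThetaEisenstein

theorem mainTheorem4 (τ : ℂ) (hτ : 0 < τ.im) :
    (9 * ThetaEisenstein.L (9 * τ) - ThetaEisenstein.L τ) ^ 2
        + (1 / 5 : ℂ) * (42 * ThetaEisenstein.M (9 * τ) - 2 * ThetaEisenstein.M τ)
      = 72 * ThetaEisenstein.vartheta1' (9 * τ) ^ 5 / ThetaEisenstein.vartheta1' τ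
        * (ThetaEisenstein.vartheta2 τ / ThetaEisenstein.vartheta2 (9 * τ) ^ 5
          - ThetaEisenstein.vartheta3 τ / ThetaEisenstein.vartheta3 (9 * τ) ^ 5
          + ThetaEisenstein.vartheta4 τ / ThetaEisenstein.vartheta4 (9 * τ) ^ 5) := by
  have h1 := ThetaEisenstein.vartheta1'_ne_zero hτ
  have h9 := ThetaEisenstein.vartheta1'_ne_zero (ThetaEisenstein.nine_mul_im_pos hτ)
  have key := ThetaEisenstein.thetaQuot_residues_eq hτ
  set Y := ThetaEisenstein.vartheta2 τ / ThetaEisenstein.vartheta2 (9 * τ) ^ 5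
    - ThetaEisenstein.vartheta3 τ / ThetaEisenstein.vartheta3 (9 * τ) ^ 5
    + ThetaEisenstein.vartheta4 τ / ThetaEisenstein.vartheta4 (9 * τ) ^ 5
  field_simp at key ⊢
  linear_combination key / 36
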